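/- Let $n\in\mathbb N$ and $j=n/2$. Let $\varphi_j:SU(2)\to U(n+1)$ be the spin-$j$ representation, i.e. the irreducible unitary representation of $SU(2)$ of dimension $n+1$, written in the standard basis of weight vectors in which the lowering operator is the matrix $J_-\in M_{\mathbb C}(n+1)$ with entries $\sqrt{n\cdot 1},\sqrt{(n-1)\cdot 2},\dots,\sqrt{1\cdot n}$ just below the diagonal and zeros elsewhere, and the raising operator is $J_+=J_-^{T}$. For $A\in M_{\mathbb C}(n+1)$ and $g\in SU(2)$ put $A^g=\varphi_j(g)A\varphi_j(g^{-1})$; let $SU(2)$ act on the unit sphere $S^2\subset\mathbb R^3$ by rotations through the standard double covering $SU(2)\to SO(3)$, characterized by $(g\mathbf n)\cdot\sigma=g(\mathbf n\cdot\sigma)g^{-1}$ with $\sigma=(\sigma_1,\sigma_2,\sigma_3)$ the Pauli matrices, and let $\mathbf n_0=(0,0,1)$. A symbol correspondence is an injective $\mathbb C$-linear map $P\mapsto W_P$ from $M_{\mathbb C}(n+1)$ to the smooth complex functions on $S^2$ such that for all $P$, all $g\in SU(2)$ and all $\mathbf n\in S^2$: $W_{P^g}(\mathbf n)=W_P(g^{-1}\mathbf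 n)$, $W_{P^*}(\mathbf n)=\overline{W_P(\mathbf n)}$, and $\frac1{4\pi}\int_{S^2}W_P\,dS=\frac1{n+1}\operatorname{trace}(P)$. For $1\le l\le n$ let $$\mathbf e^j(l,0)=\frac{(-1)^l}{l!}\sqrt{2l+1}\,\sqrt{\frac{(n-l)!}{(n+l+1)!}}\;\sum_{k=0}^{l}(-1)^k\binom lk J_-^{\,l-k}J_+^{\,l}J_-^{\,k}.$$ Then: 1. Each $\mathbf e^j(l,0)$, $1\le l\le n$, is a real diagonal matrix of trace $0$ and of unit norm, $\operatorname{trace}(\mathbf e^j(l,0)^*\mathbf e^j(l,0))=1$, and it lies in the summand $M_{\mathbb C}(\varphi_l)$ of type $\varphi_l$ (of dimension $2l+1$) of the $SU(2)$-representation $A\mapsto A^g$ on $M_{\mathbb C}(n+1)$. 2. The formula $W_P(g\mathbf n_0)=\operatorname{trace}(PK^g)$ for all $P\in M_{\mathbb C}(n+1)$, $g\in SU(2)$, defines a bijection $K\mapsto W$ from the set of real diagonal matrices of the form $$K=\frac1{n+1}I+\sum_{l=1}^n c_l\sqrt{\frac{2l+1}{n+1}}\;\mathbf e^j(l,0),\qquad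 c_l\in\mathbb R\setminus\{0\},$$ onto the set of symbol correspondences. 3. In particular, a symbol correspondence is determined by the tuple $(c_1,\dots,c_n)$: $(c_1,\dots,c_n)\mapsto W$ is a bijection from $(\mathbb R\setminus\{0\})^n$ onto the set of symbol correspondences. -/

import Mathlib

open scoped Matrix Manifold ContDiff

noncomputable section

namespace SpinJ

/-- The group `SU(2)`. -/
abbrev SU2 : Type := Matrix.specialUnitaryGroup (Fin 2) ℂ

/-- The matrix algebra `M_ℂ(n+1)`, i.e. the operators on `H_j = ℂ^{n+1}`, `n = 2j`, written in the
standard basis `u(j,j), u(j,j-1), …, u(j,-j)`, which is indexed by `0, 1, …, n`. -/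
abbrev Op (n : ℕ) : Type := Matrix (Fin (n + 1)) (Fin (n + 1)) ℂ

/-! ### The spin-`j` representation of `SU(2)` -/

/-- For `g : ℂ² → ℂ²`, the image of the monomial `e₁^(n-i) e₂^i` under the `n`-th symmetric power
of `g`, namely `(g e₁)^(n-i) (g e₂)^i`, dehomogenized by `e₁ = 1`, `e₂ = X`. -/
def spinPoly (n : ℕ) (g : Matrix (Fin 2) (Fin 2) ℂ) (i : ℕ) : Polynomial ℂ :=
  (Polynomial.C (g 0 0) + Polynomial.C (g 1 0) * Polynomial.X) ^ (n - i) *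
    (Polynomial.C (g 0 1) + Polynomial.C (g 1 1) * Polynomial.X) ^ i

/-- The matrix of the `n`-th symmetric power of `g` in the orthonormal basis
`√(n choose i) e₁^(n-i) e₂^i`, `i = 0, …, n`. With respect to this basis the
infinitesimal raising and lowering operators are the matrices `Jplus n`, `Jminus n` below. -/
def spinMatrix (n : ℕ) (g : Matrix (Fin 2) (Fin 2) ℂ) : Op n :=
  Matrix.of fun k i =>
    ((Real.sqrt (n.choose i) / Real.sqrt (n.choose k) : ℝ) : ℂ) * (spinPoly n g i).coeff k

theorem spinPoly_one (n : ℕ) (i : ℕ) : spinPoly n 1 i = Polynomial.X ^ i := by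
  simp [spinPoly]

theorem spinPoly_natDegree_lt (n : ℕ) (g : Matrix (Fin 2) (Fin 2) ℂ) (i : ℕ) (hi : i ≤ n) :
    (spinPoly n g i).natDegree < n + 1 := by
  have h : ∀ a b : ℂ, (Polynomial.C a + Polynomial.C b * Polynomial.X).natDegree ≤ 1 := by
    intro a b
    rw [add_comm]
    exact Polynomial.natDegree_linear_le
  have h1 := Polynomial.natDegree_pow_le_of_le (n - i) (h (g 0 0) (g 1 0))
  have h2 := Polynomial.natDegree_pow_le_of_le i (h (g 0 1) (g 1 1))
  have h3 := Polynomial.natDegree_mul_le_of_le h1 h2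
  rw [spinPoly]
  omega

theorem spinPoly_mul (n : ℕ) (g h : Matrix (Fin 2) (Fin 2) ℂ) (hg : g.det ≠ 0)
    (i : ℕ) (hi : i ≤ n) :
    spinPoly n (g * h) i =
      ∑ k ∈ Finset.range (n + 1), Polynomial.C ((spinPoly n h i).coeff k) * spinPoly n g k := by
  set a : Polynomial ℂ := Polynomial.C (g 0 0) + Polynomial.C (g 1 0) * Polynomial.X with ha
  set b : Polynomial ℂ := Polynomial.C (g 0 1) + Polynomial.C (g 1 1) * Polynomial.X with hb
  have ha0 : a ≠ 0 := by
    intro h0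
    apply hg
    have e0 : g 0 0 = 0 := by
      have := congrArg (fun p => Polynomial.coeff p 0) h0
      simpa [ha] using this
    have e1 : g 1 0 = 0 := by
      have := congrArg (fun p => Polynomial.coeff p 1) h0
      simpa [ha, Polynomial.coeff_C] using this
    rw [Matrix.det_fin_two, e0, e1]
    ring
  let ι : Polynomial ℂ →+* RatFunc ℂ := algebraMap (Polynomial ℂ) (RatFunc ℂ)
  have hι : Function.Injective ι := RatFunc.algebraMap_injective ℂ
  have hA : ι a ≠ 0 := fun h0 => ha0 (hι (by rw [h0, map_zero]))
  apply hι
  have key : (ι a) ^ n * (spinPoly n h i).eval₂ (ι.comp Polynomial.C) (ι b / ι a) =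
      ι (∑ k ∈ Finset.range (n + 1), Polynomial.C ((spinPoly n h i).coeff k) * spinPoly n g k) := by
    rw [Polynomial.eval₂_eq_sum_range' _ (spinPoly_natDegree_lt n h i hi), Finset.mul_sum, map_sum]
    refine Finset.sum_congr rfl fun k hk => ?_
    have hk' : k ≤ n := by
      have := Finset.mem_range.1 hk
      omega
    have : spinPoly n g k = a ^ (n - k) * b ^ k := rfl
    rw [this, map_mul, map_mul, map_pow, map_pow, div_pow, RingHom.comp_apply]
    have hp : (ι a) ^ n = (ι a) ^ (n - k) * (ι a) ^ k := by rw [← pow_add, Nat.sub_add_cancel hk']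
    rw [hp]
    field_simp
  rw [← key]
  have e1 : ∀ c d : ℂ, ι a * ((ι.comp Polynomial.C) c + (ι.comp Polynomial.C) d * (ι b / ι a)) =
      ι (Polynomial.C c * a + Polynomial.C d * b) := by
    intro c d
    simp only [RingHom.comp_apply, map_add, map_mul]
    field_simp
  have hp : (ι a) ^ n = (ι a) ^ (n - i) * (ι a) ^ i := by rw [← pow_add, Nat.sub_add_cancel hi]
  have e2 : (ι a) ^ n * (spinPoly n h i).eval₂ (ι.comp Polynomial.C) (ι b / ι a) =
      ι ((Polynomial.C (h 0 0) * a + Polynomial.C (h 1 0) * b) ^ (n - i) *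
        (Polynomial.C (h 0 1) * a + Polynomial.C (h 1 1) * b) ^ i) := by
    rw [map_mul, map_pow, map_pow, ← e1, ← e1, mul_pow, mul_pow, hp, spinPoly]
    simp only [Polynomial.eval₂_mul, Polynomial.eval₂_pow, Polynomial.eval₂_add,
      Polynomial.eval₂_C, Polynomial.eval₂_X]
    ring
  rw [e2]
  congr 1
  rw [spinPoly]
  simp only [Matrix.mul_apply, Fin.sum_univ_two, map_add, map_mul, ha, hb]
  congr 2 <;> ring

theorem spinMatrix_one (n : ℕ) : spinMatrix n 1 = 1 := by
  ext k i
  have hne : Real.sqrt (n.choose k) ≠ 0 := by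
    have : 0 < n.choose k := Nat.choose_pos (by omega)
    positivity
  simp only [spinMatrix, Matrix.of_apply, spinPoly_one, Polynomial.coeff_X_pow, Matrix.one_apply]
  by_cases hki : k = i
  · subst hki
    simp [div_self hne]
  · have : (k : ℕ) ≠ (i : ℕ) := fun h => hki (Fin.ext h)
    simp [hki, this]

theorem spinMatrix_mul (n : ℕ) (g h : Matrix (Fin 2) (Fin 2) ℂ) (hg : g.det ≠ 0) :
    spinMatrix n (g * h) = spinMatrix n g * spinMatrix n h := by
  ext k i
  simp only [spinMatrix, Matrix.of_apply, Matrix.mul_apply]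
  rw [spinPoly_mul n g h hg i (by omega), Polynomial.finsetSum_coeff, Finset.sum_range,
    Finset.mul_sum]
  refine Finset.sum_congr rfl fun m _ => ?_
  have hne : ((Real.sqrt (n.choose m) : ℝ) : ℂ) ≠ 0 := by
    have : 0 < n.choose m := Nat.choose_pos (by omega)
    rw [Complex.ofReal_ne_zero]
    positivity
  rw [Polynomial.coeff_C_mul]
  push_cast
  field_simp

/-- The irreducible unitary representation `φ_j : SU(2) → U(n+1)`, `n = 2j`, in matrix form with
respect to the standard basis. -/
def spinRep (n : ℕ) : SU2 →* Op n where
  toFun g := spinMatrix n g.1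
  map_one' := spinMatrix_one n
  map_mul' g h := spinMatrix_mul n g.1 h.1 (by
    rw [(Matrix.mem_specialUnitaryGroup_iff.1 g.2).2]
    exact one_ne_zero)

/-- The action `A ↦ A^g = φ_j(g) A φ_j(g⁻¹)` of `SU(2)` on operators. -/
def opAct (n : ℕ) (g : SU2) (A : Op n) : Op n := spinRep n g * A * spinRep n g⁻¹

/-- `M_ℂ(φ_l) ⊆ M_ℂ(n+1)`: the summand of type `φ_l` (`l` integral, of dimension `2l+1`) of the
operator space, i.e. the sum of the images of all `SU(2)`-equivariant linear maps from the
representation space of `φ_l` to `M_ℂ(n+1)`. -/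
def opSummand (n l : ℕ) : Submodule ℂ (Op n) :=
  Submodule.span ℂ {A | ∃ T : (Fin (2 * l + 1) → ℂ) →ₗ[ℂ] Op n,
    (∀ (g : SU2) (v : Fin (2 * l + 1) → ℂ), T (spinRep (2 * l) g *ᵥ v) = opAct n g (T v)) ∧
      ∃ v, T v = A}

/-! ### The 2-sphere and its rotations -/

/-- Euclidean 3-space. -/
abbrev E3 : Type := EuclideanSpace ℝ (Fin 3)

instance finrank_E3 : Fact (Module.finrank ℝ E3 = 2 + 1) := ⟨by simp⟩

/-- The unit sphere `S² ⊆ ℝ³`. -/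
abbrev S2 : Type := Metric.sphere (0 : E3) 1

/-- `x · σ = x₁ σ₁ + x₂ σ₂ + x₃ σ₃` with the Pauli matrices `σ_k`. -/
def pauli (x : E3) : Matrix (Fin 2) (Fin 2) ℂ :=
  ((x 0 : ℝ) : ℂ) • !![0, 1; 1, 0] + ((x 1 : ℝ) : ℂ) • !![0, -Complex.I; Complex.I, 0] +
    ((x 2 : ℝ) : ℂ) • !![1, 0; 0, -1]

/-- The rotation `ψ(g)` of `ℝ³`, where `ψ : SU(2) → SO(3)` is the standard two-fold covering
homomorphism; it is characterized by `(ψ(g) x) · σ = g (x · σ) g⁻¹`, see `pauli_rotVec`. -/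
def rotVec (g : SU2) (x : E3) : E3 :=
  !₂[((g.1 * pauli x * star g.1) 1 0).re, ((g.1 * pauli x * star g.1) 1 0).im,
    ((g.1 * pauli x * star g.1) 0 0).re]

theorem pauli_eq (x : E3) : pauli x =
    !![((x 2 : ℝ) : ℂ), (x 0 : ℝ) - (x 1 : ℝ) * Complex.I;
      (x 0 : ℝ) + (x 1 : ℝ) * Complex.I, -((x 2 : ℝ) : ℂ)] := by
  ext i j
  fin_cases i <;> fin_cases j <;> (simp [pauli]; try ring)

theorem pauli_rotVec (g : SU2) (x : E3) :
    pauli (rotVec g x) = g.1 * pauli x * star g.1 := by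
  set M := g.1 * pauli x * star g.1 with hM
  have hu : star g.1 * g.1 = 1 :=
    Matrix.mem_unitaryGroup_iff'.1 (Matrix.mem_specialUnitaryGroup_iff.1 g.2).1
  have hH : star M = M := by
    have hp : star (pauli x) = pauli x := by
      rw [pauli_eq]
      ext i j
      fin_cases i <;> fin_cases j <;> (simp [Matrix.star_apply]; try ring)
    rw [hM]
    simp only [star_mul, star_star, hp, mul_assoc]
  have htr : M.trace = 0 := by
    rw [hM, Matrix.trace_mul_comm, ← mul_assoc, hu, one_mul, pauli_eq]
    simp [Matrix.trace_fin_two]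
  rw [Matrix.trace_fin_two] at htr
  have h00 : (M 0 0).im = 0 := by
    have := congrArg (fun N : Matrix (Fin 2) (Fin 2) ℂ => (N 0 0).im) hH
    simp only [Matrix.star_apply, Complex.star_def, Complex.conj_im] at this
    linarith
  have h01 : star (M 1 0) = M 0 1 := congrFun (congrFun hH 0) 1
  have h11 : M 1 1 = -M 0 0 := by linear_combination htr
  have hr0 : (rotVec g x) 0 = (M 1 0).re := rfl
  have hr1 : (rotVec g x) 1 = (M 1 0).im := rfl
  have hr2 : (rotVec g x) 2 = (M 0 0).re := rfl
  rw [pauli_eq, hr0, hr1, hr2]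
  have e00 : (((M 0 0).re : ℝ) : ℂ) = M 0 0 := Complex.ext (by simp) (by simp [h00])
  ext i j
  fin_cases i <;> fin_cases j
  · simpa using e00
  · simp only [Fin.zero_eta, Fin.mk_one, ← h01]
    apply Complex.ext <;> simp
  · simp
  · simpa [h11] using e00

theorem norm_sq_eq_neg_det_pauli (x : E3) : ((‖x‖ ^ 2 : ℝ) : ℂ) = -(pauli x).det := by
  rw [EuclideanSpace.norm_sq_eq, pauli_eq, Matrix.det_fin_two]
  simp only [Fin.sum_univ_three, Real.norm_eq_abs, sq_abs]
  simp
  linear_combination (((x 1 : ℝ) : ℂ) ^ 2) * Complex.I_sq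

theorem norm_rotVec (g : SU2) (x : E3) : ‖rotVec g x‖ = ‖x‖ := by
  have hd : g.1.det = 1 := (Matrix.mem_specialUnitaryGroup_iff.1 g.2).2
  have h : ((‖rotVec g x‖ ^ 2 : ℝ) : ℂ) = ((‖x‖ ^ 2 : ℝ) : ℂ) := by
    rw [norm_sq_eq_neg_det_pauli, norm_sq_eq_neg_det_pauli, pauli_rotVec, Matrix.det_mul,
      Matrix.det_mul, Matrix.star_eq_conjTranspose, Matrix.det_conjTranspose, hd]
    simp
  have h' := Complex.ofReal_injective h
  exact (pow_left_inj₀ (norm_nonneg _) (norm_nonneg _) two_ne_zero).1 h'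

/-- The action of `g ∈ SU(2)` on `S²` through the rotation `ψ(g) ∈ SO(3)`. -/
def rot (g : SU2) (x : S2) : S2 :=
  ⟨rotVec g x.1, by
    have hx : ‖x.1‖ = 1 := by simp
    rw [mem_sphere_zero_iff_norm, norm_rotVec, hx]⟩

/-- The north pole `n₀ = (0,0,1)`. -/
def northPole : S2 := ⟨EuclideanSpace.single 2 1, by simp⟩

/-! ### Symbol correspondences -/

/-- A symbol correspondence for the spin-`j` system, `n = 2j`: a `ℂ`-linear map `P ↦ W_P` from
operators to complex functions on `S²` with the properties below. Since `A ↦ A^g` and `x ↦ g x`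
factor through the surjection `ψ : SU(2) → SO(3)`, equivariance under `SO(3)` is expressed with
`g ∈ SU(2)`. -/
structure IsSymbolCorrespondence (n : ℕ) (W : Op n →ₗ[ℂ] (S2 → ℂ)) : Prop where
  /-- every symbol is a smooth function on the sphere -/
  smooth : ∀ P, ContMDiff (𝓡 2) 𝓘(ℝ, ℂ) ∞ (W P)
  injective : Function.Injective W
  /-- `W_{P^g} = (W_P)^g`, where `F^g(x) = F(g⁻¹ x)` -/
  equivariant : ∀ (g : SU2) (P : Op n) (x : S2), W (opAct n g P) x = W P (rot g⁻¹ x)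
  /-- `W_{P^*}` is the complex conjugate of `W_P` -/
  real : ∀ (P : Op n) (x : S2), W Pᴴ x = star (W P x)
  /-- `(1/4π) ∫_{S²} W_P dS = trace(P)/(n+1)`, with the surface measure `dS` of `S²` -/
  normalized : ∀ P : Op n,
    (1 / (4 * Real.pi) : ℂ) * ∫ x, W P x ∂(MeasureTheory.volume : MeasureTheory.Measure E3).toSphere
      = (1 / (n + 1) : ℂ) * P.trace

/-- `W` is given by the matrix `K` through the formula `W_P(g n₀) = trace(P K^g)`. -/
def IsGivenBy (n : ℕ) (W : Op n →ₗ[ℂ] (S2 → ℂ)) (K : Op n) : Prop :=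
  ∀ (P : Op n) (g : SU2), W P (rot g northPole) = (P * opAct n g K).trace

/-! ### The operator kernels -/

/-- The lowering matrix `J₋`, with entries `√(n·1), √((n-1)·2), …, √(1·n)` just below the
diagonal. -/
def Jminus (n : ℕ) : Op n :=
  Matrix.of fun k i =>
    if (k : ℕ) = i + 1 then ((Real.sqrt (((n : ℝ) - i) * (i + 1)) : ℝ) : ℂ) else 0

/-- The raising matrix `J₊`, the transpose of `J₋`. -/
def Jplus (n : ℕ) : Op n := (Jminus n)ᵀ

/-- The matrix `e^j(l,0)`, `0 ≤ l ≤ n`, `n = 2j`. -/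
def coupled (n l : ℕ) : Op n :=
  (((-1) ^ l / (l.factorial : ℝ) * Real.sqrt (2 * l + 1) *
      Real.sqrt (((n - l).factorial : ℝ) / ((n + l + 1).factorial : ℝ)) : ℝ) : ℂ) •
    ∑ k ∈ Finset.range (l + 1),
      ((-1) ^ k * (l.choose k : ℂ)) • (Jminus n ^ (l - k) * Jplus n ^ l * Jminus n ^ k)

/-- `K = (1/(n+1)) I + ∑_{l=1}^n c_l √((2l+1)/(n+1)) e^j(l,0)`; the tuple `(c_1, …, c_n)` is
indexed by `i = l - 1 ∈ {0, …, n-1}`. -/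
def kernelMatrix (n : ℕ) (c : Fin n → ℝ) : Op n :=
  (1 / (n + 1) : ℂ) • (1 : Op n) +
    ∑ i : Fin n, ((c i * Real.sqrt ((2 * ((i : ℕ) + 1) + 1) / (n + 1)) : ℝ) : ℂ) •
      coupled n ((i : ℕ) + 1)

/-- The real diagonal matrices of type `kernelMatrix n c` with all `c_l ≠ 0`. -/
def kernelSet (n : ℕ) : Set (Op n) :=
  {K | (∃ d : Fin (n + 1) → ℝ, K = Matrix.diagonal fun i => (d i : ℂ)) ∧
    ∃ c : Fin n → ℝ, (∀ i, c i ≠ 0) ∧ K = kernelMatrix n c}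

end SpinJ

end

/-! Under conjugation the operator space is built from the ladders J₊^l, [J₋, J₊^l], [J₋, [J₋,
J₊^l]], …, and `coupled n l` is the normalized rung of weight zero. Everything about a ladder comes
from the terminating series e^{X ad J₋} J₊ = J₊ - 2X J₃ - X² J₋. Its l-th power `ladderPoly n l` has
degree at most 2l, and its coefficients are the rungs divided by factorials. Since ad is skew for
the trace form, the rungs can be paired explicitly: this gives orthogonality for different l and the
norm 1. The same polynomial gives an equivariant map from φ_l (`ladderMap_equivariant`): it sends
the coherent vector (e₁ + b e₂)^{2l} to the value at b, which is the l-th power of a nilpotent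
infinitesimal operator, and g moves b alike on both sides.

A symbol correspondence is determined by the functional P ↦ W_P(n₀) = trace(PK). The stabilizer of
n₀ forces K to be diagonal, reality makes it real, and normalization gives trace 1. The `coupled n
l` with 0 ≤ l ≤ n are an orthonormal basis of the real diagonal matrices, so K = ∑ κ_l e(l,0) with
κ_0 fixed by the trace. If κ_l were 0, then e(l,0) would be orthogonal to the whole orbit of K
(`trace_coupled_mul_opAct_coupled`) and have symbol 0, against injectivity.

Conversely a real diagonal K is a real polynomial p(J₃), and W_P(x) = trace(P p(x·J)) is visibly
well defined, smooth, equivariant and real. The integral of p(x·J) is invariant, hence scalar, which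
yields the normalization. The operators with zero symbol form a space stable under ad J₊ and ad J₋.
Were it nonzero, it would contain some e(l,0) (`exists_coupled_mem`), whose pairing with K is κ_l ≠
0. -/

noncomputable section

namespace SpinJ

/-! ### The angular momentum matrices -/

/-- The matrix `J₃`, with entries `n/2, n/2 - 1, …, -n/2` on the diagonal. -/
def Jz (n : ℕ) : Op n := Matrix.diagonal fun i => ((n : ℂ) / 2 - (i : ℕ))

theorem Jminus_apply (n : ℕ) (k i : Fin (n + 1)) : Jminus n k i =
    if (k : ℕ) = i + 1 then ((Real.sqrt (((n : ℝ) - i) * (i + 1)) : ℝ) : ℂ) else 0 := rfl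

theorem Jplus_apply (n : ℕ) (k i : Fin (n + 1)) : Jplus n k i = Jminus n i k := rfl

theorem ofReal_sqrt_mul_self {x : ℝ} (hx : 0 ≤ x) :
    ((Real.sqrt x : ℝ) : ℂ) * ((Real.sqrt x : ℝ) : ℂ) = (x : ℂ) := by
  rw [← Complex.ofReal_mul, Real.mul_self_sqrt hx]

theorem Jplus_mul_Jminus (n : ℕ) : Jplus n * Jminus n =
    Matrix.diagonal fun i : Fin (n + 1) => (((n : ℂ) - (i : ℕ)) * ((i : ℕ) + 1)) := by
  ext k i
  rw [Matrix.mul_apply, Matrix.diagonal_apply]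
  simp only [Jplus_apply, Jminus_apply]
  have hi : (0 : ℝ) ≤ ((n : ℝ) - i) * (i + 1) := by
    have : ((i : ℕ) : ℝ) ≤ n := by exact_mod_cast Nat.lt_succ_iff.1 i.2
    have := sub_nonneg.2 this
    positivity
  split_ifs with h
  · subst h
    by_cases hk : (k : ℕ) = n
    · rw [Finset.sum_eq_zero]
      · simp [hk]
      · intro m _
        rw [if_neg (by omega), zero_mul]
    · rw [Finset.sum_eq_single ⟨k + 1, by omega⟩]
      · rw [if_pos rfl, ofReal_sqrt_mul_self hi]
        push_cast
        rfl
      · intro m _ hm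
        rw [if_neg (fun h => hm (Fin.ext h)), zero_mul]
      · simp
  · apply Finset.sum_eq_zero
    intro m _
    by_cases h1 : (m : ℕ) = k + 1
    · rw [if_neg (c := (m : ℕ) = i + 1), mul_zero]
      intro h2
      exact h (Fin.ext (by omega))
    · rw [if_neg h1, zero_mul]

theorem Jminus_mul_Jplus (n : ℕ) : Jminus n * Jplus n =
    Matrix.diagonal fun i : Fin (n + 1) => (((n : ℂ) - (i : ℕ) + 1) * (i : ℕ)) := by
  ext k i
  rw [Matrix.mul_apply, Matrix.diagonal_apply]
  simp only [Jplus_apply, Jminus_apply]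
  split_ifs with h
  · subst h
    by_cases hk : (k : ℕ) = 0
    · rw [Finset.sum_eq_zero]
      · simp [hk]
      · intro m _
        rw [if_neg (by omega), zero_mul]
    · rw [Finset.sum_eq_single ⟨k - 1, by omega⟩]
      · have e : (k : ℕ) = (k - 1) + 1 := by omega
        have e2 : (((k - 1 : ℕ)) : ℝ) = (k : ℝ) - 1 := by
          rw [Nat.cast_sub (by omega)]; simp
        have hi : (0 : ℝ) ≤ ((n : ℝ) - (k - 1 : ℕ)) * ((k - 1 : ℕ) + 1) := by
          have : (((k - 1 : ℕ)) : ℝ) ≤ n := by exact_mod_cast (by omega)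
          have := sub_nonneg.2 this
          positivity
        rw [if_pos e, ofReal_sqrt_mul_self hi, e2]
        push_cast
        ring
      · intro m _ hm
        rw [if_neg (fun h => hm (Fin.ext (by simp; omega))), zero_mul]
      · simp
  · apply Finset.sum_eq_zero
    intro m _
    by_cases h1 : (k : ℕ) = m + 1
    · rw [if_neg (c := (i : ℕ) = m + 1), mul_zero]
      intro h2
      exact h (Fin.ext (by omega))
    · rw [if_neg h1, zero_mul]

theorem Jplus_comm_Jminus (n : ℕ) : Jplus n * Jminus n - Jminus n * Jplus n = (2 : ℂ) • Jz n := by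
  rw [Jplus_mul_Jminus, Jminus_mul_Jplus, Jz, Matrix.diagonal_sub, ← Matrix.diagonal_smul]
  congr 1
  ext i
  simp only [Pi.smul_apply, smul_eq_mul]
  ring

theorem Jminus_comm_Jz (n : ℕ) : Jminus n * Jz n - Jz n * Jminus n = Jminus n := by
  ext k i
  rw [Matrix.sub_apply, Jz, Matrix.mul_diagonal, Matrix.diagonal_mul, Jminus_apply]
  split_ifs with h
  · rw [h]
    push_cast
    ring
  · simp

theorem Jminus_conjTranspose (n : ℕ) : (Jminus n)ᴴ = Jplus n := by
  ext k i
  rw [Matrix.conjTranspose_apply, Jplus_apply, Jminus_apply]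
  split_ifs <;> simp

theorem Jplus_conjTranspose (n : ℕ) : (Jplus n)ᴴ = Jminus n := by
  rw [← Jminus_conjTranspose, Matrix.conjTranspose_conjTranspose]

theorem Jz_conjTranspose (n : ℕ) : (Jz n)ᴴ = Jz n := by
  rw [Jz, Matrix.diagonal_conjTranspose]
  congr 1
  ext i
  simp

/-! ### Powers of the ladder matrices and the trace behind the normalization -/

/-- The entries of the powers of `J₋`. -/
theorem Jminus_pow_apply (n p : ℕ) (k i : Fin (n + 1)) : (Jminus n ^ p) k i =
    if (k : ℕ) = i + p then
      ((Real.sqrt (((n - i : ℕ).descFactorial p : ℝ) * (((i : ℕ) + 1).ascFactorial p : ℝ)) : ℝ) : ℂ)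
    else 0 := by
  induction p generalizing k with
  | zero =>
    simp [Matrix.one_apply, Fin.ext_iff]
  | succ p ih =>
    rw [pow_succ', Matrix.mul_apply]
    simp only [ih, Jminus_apply]
    by_cases hk : (k : ℕ) = i + (p + 1)
    · rw [Finset.sum_eq_single ⟨i + p, by omega⟩]
      · have e : ((n : ℝ) - ((i + p : ℕ) : ℝ)) = ((n - i - p : ℕ) : ℝ) := by
          rw [Nat.sub_sub, Nat.cast_sub (by omega)]
        rw [if_pos (by simp; omega), if_pos rfl, if_pos hk, ← Complex.ofReal_mul, e,
          ← Real.sqrt_mul (by positivity)]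
        congr 2
        rw [Nat.descFactorial_succ, Nat.ascFactorial_succ]
        push_cast
        ring
      · intro m _ hm
        rw [if_neg (c := (m : ℕ) = i + p) (fun h => hm (Fin.ext h)), mul_zero]
      · simp
    · rw [if_neg hk]
      apply Finset.sum_eq_zero
      intro m _
      by_cases h1 : (m : ℕ) = i + p
      · rw [if_neg (by omega), zero_mul]
      · rw [if_neg h1, mul_zero]

theorem Jminus_pow_eq_zero (n : ℕ) : Jminus n ^ (n + 1) = 0 := by
  ext k i
  rw [Jminus_pow_apply, if_neg (by omega), Matrix.zero_apply]

theorem Jplus_pow (n p : ℕ) : Jplus n ^ p = (Jminus n ^ p)ᵀ := by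
  rw [Jplus, Matrix.transpose_pow]

theorem Jplus_pow_eq_zero (n : ℕ) : Jplus n ^ (n + 1) = 0 := by
  rw [Jplus_pow, Jminus_pow_eq_zero, Matrix.transpose_zero]

/-- Compare the coefficients of X^m in (1 - X)^{-(l+1)} (1 - X)^{-(l+1)} = (1 - X)^{-(2l+2)}. -/
theorem sum_choose_mul_choose_antidiagonal (l m : ℕ) :
    ∑ x ∈ Finset.HasAntidiagonal.antidiagonal m, (l + x.1).choose l * (l + x.2).choose l =
      (2 * l + 1 + m).choose (2 * l + 1) := by
  have h := congrArg (fun u : (PowerSeries ℤ)ˣ => PowerSeries.coeff m (u : PowerSeries ℤ))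
    (PowerSeries.invOneSubPow_add (S := ℤ) (l + 1) (l + 1))
  simp only [Units.val_mul] at h
  rw [show l + 1 + (l + 1) = (2 * l + 1) + 1 by ring] at h
  simp only [PowerSeries.invOneSubPow_val_succ_eq_mk_add_choose, PowerSeries.coeff_mul,
    PowerSeries.coeff_mk] at h
  exact_mod_cast h.symm

/-- The i-th diagonal entry is l!² C(n-i, l) C(l+i, l), so the trace is a convolution of binomial
coefficients. This number dictates the square roots in the normalization of `coupled`. -/
theorem trace_Jplus_pow_mul_Jminus_pow (n l : ℕ) (hl : l ≤ n) :
    (Jplus n ^ l * Jminus n ^ l).trace =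
      ((l.factorial ^ 2 * (n + l + 1).choose (2 * l + 1) : ℕ) : ℂ) := by
  have h1 : ∀ i : Fin (n + 1), (Jplus n ^ l * Jminus n ^ l) i i =
      ((if (i : ℕ) + l ≤ n then (n - i).descFactorial l * ((i : ℕ) + 1).ascFactorial l else 0 : ℕ)
        : ℂ) := by
    intro i
    rw [Matrix.mul_apply]
    simp only [Jplus_pow, Matrix.transpose_apply, Jminus_pow_apply]
    split_ifs with h
    · rw [Finset.sum_eq_single ⟨i + l, by omega⟩]
      · rw [if_pos rfl, ofReal_sqrt_mul_self (by positivity)]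
        push_cast
        rfl
      · intro m _ hm
        rw [if_neg (fun h => hm (Fin.ext h)), zero_mul]
      · simp
    · rw [Nat.cast_zero]
      apply Finset.sum_eq_zero
      intro m _
      rw [if_neg (by omega), zero_mul]
  rw [Matrix.trace]
  simp only [Matrix.diag_apply, h1]
  rw [← Nat.cast_sum, Nat.cast_inj, Fin.sum_univ_eq_sum_range
    (fun i => if i + l ≤ n then (n - i).descFactorial l * (i + 1).ascFactorial l else 0),
    ← Finset.sum_filter]
  have h2 : (Finset.range (n + 1)).filter (fun i => i + l ≤ n) = Finset.range (n - l + 1) := by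
    ext i
    simp only [Finset.mem_filter, Finset.mem_range]
    omega
  have h3 := sum_choose_mul_choose_antidiagonal l (n - l)
  rw [Finset.Nat.sum_antidiagonal_eq_sum_range_succ_mk,
    show 2 * l + 1 + (n - l) = n + l + 1 by omega] at h3
  rw [h2, ← h3, Finset.mul_sum]
  refine Finset.sum_congr rfl fun i hi => ?_
  have hi' := Finset.mem_range.1 hi
  rw [Nat.descFactorial_eq_factorial_mul_choose, Nat.ascFactorial_eq_factorial_mul_choose]
  rw [show l + (n - l - i) = n - i by omega, show i + l = l + i by omega]
  ring

/-! ### Lowering the powers of `J₊` -/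

/-- The commutator `A ↦ [J, A]` as a linear map. -/
def ad {n : ℕ} (J : Op n) : Op n →ₗ[ℂ] Op n := LinearMap.mulLeft ℂ J - LinearMap.mulRight ℂ J

theorem ad_apply {n : ℕ} (J A : Op n) : ad J A = J * A - A * J := rfl

/-- Cyclicity makes ad J skew for the trace form, so commutators can be moved from one factor to the
other. -/
theorem trace_ad_mul {n : ℕ} (J A B : Op n) : (ad J A * B).trace = -(A * ad J B).trace := by
  rw [ad_apply, ad_apply, sub_mul, mul_sub, Matrix.trace_sub, Matrix.trace_sub, mul_assoc,
    Matrix.trace_mul_comm J, mul_assoc, mul_assoc]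
  ring

theorem trace_ad_pow_mul {n : ℕ} (J A B : Op n) (m : ℕ) :
    ((ad J ^ m) A * B).trace = (-1) ^ m * (A * (ad J ^ m) B).trace := by
  induction m generalizing A with
  | zero => simp
  | succ m ih =>
    rw [pow_succ, Module.End.mul_apply, ih, trace_ad_mul, ← Module.End.mul_apply, ← pow_succ',
      ← pow_succ, pow_succ (-1 : ℂ)]
    ring

theorem ad_transpose {n : ℕ} (J A : Op n) : (ad J A)ᵀ = -ad Jᵀ Aᵀ := by
  rw [ad_apply, ad_apply, Matrix.transpose_sub, Matrix.transpose_mul, Matrix.transpose_mul, neg_sub]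

theorem ad_pow_transpose {n : ℕ} (J A : Op n) (m : ℕ) :
    ((ad J ^ m) A)ᵀ = (-1 : ℂ) ^ m • (ad Jᵀ ^ m) Aᵀ := by
  induction m with
  | zero => simp
  | succ m ih =>
    rw [pow_succ', Module.End.mul_apply, ad_transpose, ih, map_smul, pow_succ' (ad Jᵀ),
      Module.End.mul_apply, pow_succ', mul_smul, neg_one_smul]

theorem neg_mulRight_pow_apply {n : ℕ} (J A : Op n) (k : ℕ) :
    ((-LinearMap.mulRight ℂ J) ^ k) A = (-1 : ℂ) ^ k • (A * J ^ k) := by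
  induction k with
  | zero => simp
  | succ k ih =>
    rw [pow_succ', Module.End.mul_apply, ih, map_smul, LinearMap.neg_apply,
      LinearMap.mulRight_apply, mul_assoc, ← pow_succ, pow_succ' (-1 : ℂ), mul_smul, smul_neg,
      neg_one_smul]

/-- Left and right multiplication commute, so the binomial theorem applies. This recognizes the sum
in `coupled` as an iterated commutator. -/
theorem ad_pow_apply {n : ℕ} (J A : Op n) (l : ℕ) :
    (ad J ^ l) A = ∑ k ∈ Finset.range (l + 1),
      ((-1) ^ k * (l.choose k : ℂ)) • (J ^ (l - k) * A * J ^ k) := by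
  have hc : Commute (-LinearMap.mulRight ℂ J) (LinearMap.mulLeft ℂ J) :=
    (LinearMap.commute_mulLeft_right (R := ℂ) J J).symm.neg_left
  have he : ad J = -LinearMap.mulRight ℂ J + LinearMap.mulLeft ℂ J := by
    rw [ad, sub_eq_add_neg]
    exact add_comm _ _
  rw [he, hc.add_pow, LinearMap.sum_apply]
  refine Finset.sum_congr rfl fun k _ => ?_
  rw [← nsmul_eq_mul', LinearMap.smul_apply, Module.End.mul_apply, LinearMap.pow_mulLeft,
    neg_mulRight_pow_apply, LinearMap.mulLeft_apply, ← Nat.cast_smul_eq_nsmul ℂ, smul_smul,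
    mul_comm]

/-- The polynomial `(J₊ - 2 X J₃ - X² J₋)^l`, whose coefficients are the successive lowerings of
`J₊^l`. -/
def ladderPoly (n l : ℕ) : Polynomial (Op n) :=
  (Polynomial.C (Jplus n) - Polynomial.C ((2 : ℂ) • Jz n) * Polynomial.X -
    Polynomial.C (Jminus n) * Polynomial.X ^ 2) ^ l

/-- Under these relations the quadratic is e^{X ad c} a, which stops after X²; the identity is its
differential equation q' = [c, q]. -/
theorem derivative_quadratic_eq_commutator {R : Type*} [Ring R] (a b c : R)
    (h₁ : a * c - c * a = b) (h₂ : c * b - b * c = 2 * c) :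
    Polynomial.derivative (Polynomial.C a - Polynomial.C b * Polynomial.X -
        Polynomial.C c * Polynomial.X ^ 2) =
      Polynomial.C c * (Polynomial.C a - Polynomial.C b * Polynomial.X -
        Polynomial.C c * Polynomial.X ^ 2) -
      (Polynomial.C a - Polynomial.C b * Polynomial.X -
        Polynomial.C c * Polynomial.X ^ 2) * Polynomial.C c := by
  ext k
  simp only [Polynomial.coeff_derivative, Polynomial.coeff_sub, Polynomial.coeff_C_mul,
    Polynomial.coeff_mul_C, Polynomial.coeff_C, Polynomial.coeff_X, Polynomial.coeff_X_pow]
  match k with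
  | 0 => simp [← h₁]
  | 1 =>
    have : b * c = c * b - 2 * c := by rw [← h₂]; abel
    simp [this, mul_add, two_mul]
    abel
  | 2 => simp
  | k + 3 => simp

/-- Differentiation and commutation with c are both derivations, so agreement on p passes to its
powers. -/
theorem derivative_pow_eq_commutator {R : Type*} [Ring R] (c : R) (p : Polynomial R)
    (h : Polynomial.derivative p = Polynomial.C c * p - p * Polynomial.C c) (l : ℕ) :
    Polynomial.derivative (p ^ l) = Polynomial.C c * p ^ l - p ^ l * Polynomial.C c := by
  induction l with
  | zero => simp
  | succ l ih =>
    rw [pow_succ, Polynomial.derivative_mul, ih, h]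
    noncomm_ring

theorem derivative_ladderPoly (n l : ℕ) : Polynomial.derivative (ladderPoly n l) =
    Polynomial.C (Jminus n) * ladderPoly n l - ladderPoly n l * Polynomial.C (Jminus n) :=
  derivative_pow_eq_commutator _ _ (derivative_quadratic_eq_commutator (Jplus n)
    ((2 : ℂ) • Jz n) (Jminus n) (Jplus_comm_Jminus n)
    (by rw [mul_smul_comm, smul_mul_assoc, ← smul_sub, Jminus_comm_Jz, two_smul, two_mul])) l

/-- The equation p' = [J₋, p] is the recursion (m+1) p_{m+1} = [J₋, p_m], and it starts at p_0 =
J₊^l. -/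
theorem ad_pow_Jplus_pow (n l m : ℕ) :
    (ad (Jminus n) ^ m) (Jplus n ^ l) = (m.factorial : ℂ) • (ladderPoly n l).coeff m := by
  induction m with
  | zero =>
    have h (p : Polynomial (Op n)) : (p ^ l).coeff 0 = p.coeff 0 ^ l :=
      map_pow Polynomial.constantCoeff p l
    simp [ladderPoly, h]
  | succ m ih =>
    have h := congrArg (fun p => Polynomial.coeff p m) (derivative_ladderPoly n l)
    simp only [Polynomial.coeff_derivative, Polynomial.coeff_sub, Polynomial.coeff_C_mul,
      Polynomial.coeff_mul_C] at h
    rw [pow_succ', Module.End.mul_apply, ih, map_smul, ad_apply, ← h, Nat.factorial_succ,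
      Nat.cast_mul, mul_comm, mul_smul]
    congr 1
    rw [← Nat.cast_succ, ← nsmul_eq_mul', Nat.cast_smul_eq_nsmul]

theorem ladderPoly_one_natDegree_le (n : ℕ) : (Polynomial.C (Jplus n) -
    Polynomial.C ((2 : ℂ) • Jz n) * Polynomial.X -
    Polynomial.C (Jminus n) * Polynomial.X ^ 2).natDegree ≤ 2 := by
  compute_degree

theorem ladderPoly_natDegree_le (n l : ℕ) : (ladderPoly n l).natDegree ≤ 2 * l := by
  have := Polynomial.natDegree_pow_le_of_le l (ladderPoly_one_natDegree_le n)
  rw [ladderPoly]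
  omega

theorem ladderPoly_coeff_two_mul (n l : ℕ) :
    (ladderPoly n l).coeff (2 * l) = (-Jminus n) ^ l := by
  rw [ladderPoly, mul_comm, Polynomial.coeff_pow_of_natDegree_le (ladderPoly_one_natDegree_le n)]
  congr 1
  simp

theorem ad_pow_Jplus_pow_eq_zero (n l m : ℕ) (hm : 2 * l < m) :
    (ad (Jminus n) ^ m) (Jplus n ^ l) = 0 := by
  rw [ad_pow_Jplus_pow, Polynomial.coeff_eq_zero_of_natDegree_lt, smul_zero]
  exact (ladderPoly_natDegree_le n l).trans_lt hm

theorem ad_pow_Jplus_pow_two_mul (n l : ℕ) :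
    (ad (Jminus n) ^ (2 * l)) (Jplus n ^ l) =
      ((-1) ^ l * ((2 * l).factorial : ℂ)) • Jminus n ^ l := by
  rw [ad_pow_Jplus_pow, ladderPoly_coeff_two_mul, mul_comm, mul_smul]
  rcases Nat.even_or_odd l with h | h
  · simp [h.neg_pow]
  · simp [h.neg_pow]

/-- Transposition exchanges J₊ and J₋ and negates each commutator; the number of commutators is
even, so no sign remains. -/
theorem ad_Jplus_pow_Jminus_pow_two_mul (n l : ℕ) :
    (ad (Jplus n) ^ (2 * l)) (Jminus n ^ l) =
      ((-1) ^ l * ((2 * l).factorial : ℂ)) • Jplus n ^ l := by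
  have h := congrArg Matrix.transpose (ad_pow_Jplus_pow_two_mul n l)
  rw [ad_pow_transpose, Matrix.transpose_smul, Jplus_pow, Matrix.transpose_transpose,
    ← Jplus_pow, pow_mul (-1 : ℂ)] at h
  simpa [Jplus] using h

/-! ### Orthonormality and diagonal form of the coupled matrices -/

/-- The normalization factor of `coupled n l`. -/
def coupledCoeff (n l : ℕ) : ℝ :=
  (-1) ^ l / (l.factorial : ℝ) * Real.sqrt (2 * l + 1) *
      Real.sqrt (((n - l).factorial : ℝ) / ((n + l + 1).factorial : ℝ))

theorem coupledCoeff_ne_zero (n l : ℕ) : coupledCoeff n l ≠ 0 := by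
  unfold coupledCoeff
  have h1 : (0 : ℝ) < 2 * l + 1 := by positivity
  have h2 : 0 < ((n - l).factorial : ℝ) / ((n + l + 1).factorial : ℝ) := by positivity
  have h3 := Real.sqrt_pos.2 h1
  have h4 := Real.sqrt_pos.2 h2
  have h5 : ((-1 : ℝ) ^ l) ≠ 0 := pow_ne_zero _ (by norm_num)
  positivity

theorem coupled_eq (n l : ℕ) :
    coupled n l = (coupledCoeff n l : ℂ) • (ad (Jminus n) ^ l) (Jplus n ^ l) := by
  rw [ad_pow_apply]
  rfl

theorem trace_ad_pow_Jplus_pow_mul_of_lt {n l l' m m' : ℕ} (h : 2 * l' < m + m') :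
    ((ad (Jminus n) ^ m) (Jplus n ^ l) * (ad (Jminus n) ^ m') (Jplus n ^ l')).trace = 0 := by
  rw [trace_ad_pow_mul, ← Module.End.mul_apply, ← pow_add, ad_pow_Jplus_pow_eq_zero _ _ _ h]
  simp

theorem trace_coupled_mul_coupled_of_ne {n l l' : ℕ} (h : l ≠ l') :
    (coupled n l * coupled n l').trace = 0 := by
  rw [coupled_eq, coupled_eq, smul_mul_smul_comm, Matrix.trace_smul]
  rcases lt_or_gt_of_ne h with h | h
  -- All l + l' commutators are moved onto the power of J₊ with the smaller exponent, which they
  -- annihilate; here that factor must first be brought to the right.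
  · rw [Matrix.trace_mul_comm, trace_ad_pow_Jplus_pow_mul_of_lt (by omega), smul_zero]
  · rw [trace_ad_pow_Jplus_pow_mul_of_lt (by omega), smul_zero]

/-- Moving all commutators onto one factor lowers J₊^l exactly 2l times, to a multiple of J₋^l. The
two signs (-1)^l cancel and the known trace of J₊^l J₋^l is what the normalization inverts. -/
theorem trace_coupled_mul_self {n l : ℕ} (hl : l ≤ n) :
    (coupled n l * coupled n l).trace = 1 := by
  have h2 : ((-1 : ℂ) ^ l * (-1) ^ l) = 1 := by rw [← mul_pow]; simp
  rw [coupled_eq, smul_mul_smul_comm, Matrix.trace_smul, trace_ad_pow_mul, ← Module.End.mul_apply,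
    ← pow_add, ← two_mul, ad_pow_Jplus_pow_two_mul, mul_smul_comm, Matrix.trace_smul,
    trace_Jplus_pow_mul_Jminus_pow n l hl, ← Complex.ofReal_mul, smul_eq_mul, smul_eq_mul]
  have h1 : coupledCoeff n l * coupledCoeff n l =
      (2 * l + 1) * ((n - l).factorial / (n + l + 1).factorial) / (l.factorial : ℝ) ^ 2 := by
    have a1 : Real.sqrt (2 * l + 1) ^ 2 = 2 * l + 1 := Real.sq_sqrt (by positivity)
    have a2 := Real.sq_sqrt (x := ((n - l).factorial : ℝ) / ((n + l + 1).factorial : ℝ))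
      (by positivity)
    have a3 : ((-1 : ℝ) ^ l) ^ 2 = 1 := by rw [← pow_mul, mul_comm, pow_mul]; simp
    rw [← sq, coupledCoeff, mul_pow, mul_pow, a1, a2, div_pow, a3]
    ring
  have h3 := Nat.choose_mul_factorial_mul_factorial (show 2 * l + 1 ≤ n + l + 1 by omega)
  rw [show n + l + 1 - (2 * l + 1) = n - l by omega, Nat.factorial_succ (2 * l)] at h3
  have h4 : (((n + l + 1).choose (2 * l + 1) : ℕ) : ℂ) * ((2 * l + 1) * ((2 * l).factorial : ℂ)) *
      ((n - l).factorial : ℂ) = ((n + l + 1).factorial : ℂ) := by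
    exact_mod_cast h3
  have h5 : ((n + l + 1).factorial : ℂ) ≠ 0 := by exact_mod_cast Nat.factorial_ne_zero _
  have h6 : (l.factorial : ℂ) ≠ 0 := by exact_mod_cast Nat.factorial_ne_zero _
  rw [h1]
  push_cast
  calc _ = ((-1 : ℂ) ^ l * (-1) ^ l) * ((((n + l + 1).choose (2 * l + 1) : ℕ) : ℂ) *
      ((2 * l + 1) * ((2 * l).factorial : ℂ)) * ((n - l).factorial : ℂ)) /
        ((n + l + 1).factorial : ℂ) := by
        field_simp
    _ = 1 := by rw [h2, h4, one_mul, div_self h5]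

/-- This is orthogonality to the case l = 0, a nonzero multiple of the identity. -/
theorem trace_coupled {n l : ℕ} (hl : 1 ≤ l) : (coupled n l).trace = 0 := by
  have h := trace_coupled_mul_coupled_of_ne (n := n) (l := l) (l' := 0) (by omega)
  rw [coupled_eq n 0, mul_smul_comm, Matrix.trace_smul, smul_eq_mul] at h
  simpa [coupledCoeff_ne_zero] using h

theorem coupled_zero (n : ℕ) : coupled n 0 = ((Real.sqrt (1 / (n + 1)) : ℝ) : ℂ) • (1 : Op n) := by
  rw [coupled_eq]
  simp only [pow_zero, Module.End.one_apply, coupledCoeff]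
  congr 2
  simp [Nat.factorial_succ]
  field_simp

/-- `A` is supported on the entries `(k, i)` with `k = i + s`. -/
def HasShift {n : ℕ} (A : Op n) (s : ℤ) : Prop := ∀ k i, A k i ≠ 0 → ((k : ℕ) : ℤ) = (i : ℕ) + s

theorem HasShift.mul {n : ℕ} {A B : Op n} {s t : ℤ} (hA : HasShift A s) (hB : HasShift B t) :
    HasShift (A * B) (s + t) := by
  intro k i h
  rw [Matrix.mul_apply] at h
  obtain ⟨m, -, hm⟩ := Finset.exists_ne_zero_of_sum_ne_zero h
  have h1 := hA k m (left_ne_zero_of_mul hm)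
  have h2 := hB m i (right_ne_zero_of_mul hm)
  omega

theorem HasShift.sub {n : ℕ} {A B : Op n} {s : ℤ} (hA : HasShift A s) (hB : HasShift B s) :
    HasShift (A - B) s := by
  intro k i h
  by_cases h1 : A k i = 0
  · exact hB k i (fun h2 => h (by rw [Matrix.sub_apply, h1, h2, sub_zero]))
  · exact hA k i h1

theorem hasShift_Jminus (n : ℕ) : HasShift (Jminus n) 1 := by
  intro k i h
  rw [Jminus_apply] at h
  split_ifs at h with h1
  · omega
  · simp at h

theorem hasShift_Jplus_pow (n l : ℕ) : HasShift (Jplus n ^ l) (-l) := by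
  intro k i h
  rw [Jplus_pow, Matrix.transpose_apply, Jminus_pow_apply] at h
  split_ifs at h with h1
  · omega
  · simp at h

theorem hasShift_ad_pow (n l m : ℕ) :
    HasShift ((ad (Jminus n) ^ m) (Jplus n ^ l)) (m - l) := by
  induction m with
  | zero => simpa using hasShift_Jplus_pow n l
  | succ m ih =>
    rw [pow_succ', Module.End.mul_apply, ad_apply]
    have h1 := (hasShift_Jminus n).mul ih
    have h2 := ih.mul (hasShift_Jminus n)
    rw [show (1 : ℤ) + (m - l) = ((m + 1 : ℕ) : ℤ) - l by push_cast; ring] at h1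
    rw [show (m : ℤ) - l + 1 = ((m + 1 : ℕ) : ℤ) - l by push_cast; ring] at h2
    exact h1.sub h2

theorem HasShift.trace_mul_eq_zero {n : ℕ} {A B : Op n} {s t : ℤ} (hA : HasShift A s)
    (hB : HasShift B t) (h : s + t ≠ 0) : (A * B).trace = 0 := by
  rw [Matrix.trace]
  refine Finset.sum_eq_zero fun i _ => ?_
  by_contra h1
  have := (hA.mul hB) i i h1
  omega

/-- Only the rung m = l' has weight zero and can pair with a diagonal matrix; that rung is
proportional to `coupled n l'`. -/
theorem trace_coupled_mul_ad_pow_eq_zero {n l l' : ℕ} (h : l ≠ l') (m : ℕ) :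
    (coupled n l * (ad (Jminus n) ^ m) (Jplus n ^ l')).trace = 0 := by
  by_cases hm : m = l'
  · subst hm
    have h1 := trace_coupled_mul_coupled_of_ne (n := n) h
    rw [coupled_eq n m, mul_smul_comm, Matrix.trace_smul, smul_eq_mul] at h1
    simpa [coupledCoeff_ne_zero] using h1
  · rw [coupled_eq, smul_mul_assoc, Matrix.trace_smul,
      (hasShift_ad_pow n l l).trace_mul_eq_zero (hasShift_ad_pow n l' m) (by omega), smul_zero]

theorem map_conj_Jminus (n : ℕ) : (Jminus n).map (starRingEnd ℂ) = Jminus n := by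
  ext k i
  rw [Matrix.map_apply, Jminus_apply]
  split_ifs <;> simp

theorem map_conj_ad_pow (n l m : ℕ) : ((ad (Jminus n) ^ m) (Jplus n ^ l)).map (starRingEnd ℂ) =
    (ad (Jminus n) ^ m) (Jplus n ^ l) := by
  induction m with
  | zero =>
    rw [pow_zero, Module.End.one_apply, Jplus_pow, Matrix.transpose_map, Matrix.map_pow,
      map_conj_Jminus]
  | succ m ih =>
    rw [pow_succ', Module.End.mul_apply, ad_apply, Matrix.map_sub _ (by simp), Matrix.map_mul,
      Matrix.map_mul, ih, map_conj_Jminus]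

/-- The diagonal entries of `coupled n l`. -/
def coupledDiag (n l : ℕ) (i : Fin (n + 1)) : ℝ := (coupled n l i i).re

/-- Lowering J₊^l as often as it raises leaves shift zero, and all entries of J₊ and J₋ are real. -/
theorem coupled_eq_diagonal (n l : ℕ) :
    coupled n l = Matrix.diagonal fun i => (coupledDiag n l i : ℂ) := by
  ext k i
  rw [Matrix.diagonal_apply]
  split_ifs with h
  · subst h
    have h1 := congrArg (fun A : Op n => A k k) (map_conj_ad_pow n l l)
    apply (Complex.conj_eq_iff_re.1 _).symm
    rw [coupled_eq, Matrix.smul_apply, smul_eq_mul, map_mul, Complex.conj_ofReal]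
    congr 1
  · rw [coupled_eq, Matrix.smul_apply]
    by_contra h1
    have := hasShift_ad_pow n l l k i (fun h2 => h1 (by rw [h2, smul_zero]))
    exact h (Fin.ext (by omega))

theorem coupled_conjTranspose (n l : ℕ) : (coupled n l)ᴴ = coupled n l := by
  rw [coupled_eq_diagonal, Matrix.diagonal_conjTranspose]
  congr 1
  ext i
  simp

/-! ### The derivative of the spin representation -/

/-- The coefficients of the curve `p` of polynomials are differentiable at `0`, and their
derivatives are the coefficients of `p'`. -/
def CoeffHasDerivAt (p : ℝ → Polynomial ℂ) (p' : Polynomial ℂ) : Prop :=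
  ∀ k, HasDerivAt (fun t => (p t).coeff k) (p'.coeff k) 0

theorem CoeffHasDerivAt.mul {p q : ℝ → Polynomial ℂ} {p' q' : Polynomial ℂ}
    (hp : CoeffHasDerivAt p p') (hq : CoeffHasDerivAt q q') :
    CoeffHasDerivAt (fun t => p t * q t) (p' * q 0 + p 0 * q') := by
  intro k
  simp only [Polynomial.coeff_mul, Polynomial.coeff_add, ← Finset.sum_add_distrib]
  exact HasDerivAt.fun_sum fun x _ => (hp x.1).mul (hq x.2)

theorem CoeffHasDerivAt.pow {p : ℝ → Polynomial ℂ} {p' : Polynomial ℂ}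
    (hp : CoeffHasDerivAt p p') (m : ℕ) :
    CoeffHasDerivAt (fun t => p t ^ m) (m * p 0 ^ (m - 1) * p') := by
  induction m with
  | zero =>
    intro k
    simpa using hasDerivAt_const (0 : ℝ) _
  | succ m ih =>
    have h := ih.mul hp
    simp only [← pow_succ] at h
    convert h using 1
    rcases m with _ | m
    · simp
    · simp only [Nat.add_sub_cancel]
      push_cast
      ring

theorem coeffHasDerivAt_linear {a b : ℝ → ℂ} {a' b' : ℂ} (ha : HasDerivAt a a' 0)
    (hb : HasDerivAt b b' 0) :
    CoeffHasDerivAt (fun t => Polynomial.C (a t) + Polynomial.C (b t) * Polynomial.X)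
      (Polynomial.C a' + Polynomial.C b' * Polynomial.X) := by
  intro k
  simp only [Polynomial.coeff_add, Polynomial.coeff_C_mul, Polynomial.coeff_C, Polynomial.coeff_X]
  refine HasDerivAt.add ?_ (hb.mul_const _)
  split_ifs
  · exact ha
  · exact hasDerivAt_const _ _

/-- The derivative at the identity of the `n`-th symmetric power, in the direction `X`. -/
def dspin (n : ℕ) (X : Matrix (Fin 2) (Fin 2) ℂ) : Op n :=
  ((X 0 0 + X 1 1) * (n / 2)) • (1 : Op n) + (X 0 0 - X 1 1) • Jz n + X 0 1 • Jplus n +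
    X 1 0 • Jminus n

theorem sqrt_choose_succ (n i : ℕ) (hi : i < n) :
    Real.sqrt (n.choose (i + 1)) * Real.sqrt (i + 1) = Real.sqrt (n.choose i) * Real.sqrt (n - i) := by
  rw [← Real.sqrt_mul (by positivity), ← Real.sqrt_mul (by positivity)]
  congr 1
  have h := Nat.choose_succ_right_eq n i
  rw [← Nat.cast_sub hi.le]
  exact_mod_cast h

/-- The norm ratio of neighbouring monomials turns the integer factor of the derivative into the
square-root entry of the ladder matrix. -/
theorem sqrt_choose_div_succ (n i : ℕ) (hi : i < n) :
    Real.sqrt (n.choose i) / Real.sqrt (n.choose (i + 1)) * (n - i) =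
      Real.sqrt ((n - i) * (i + 1)) := by
  have h := sqrt_choose_succ n i hi
  have h1 : 0 < Real.sqrt (n.choose (i + 1)) :=
    Real.sqrt_pos.2 (by exact_mod_cast Nat.choose_pos (by omega))
  have h2 : (0 : ℝ) ≤ n - i := sub_nonneg.2 (by exact_mod_cast hi.le)
  have h3 := Real.mul_self_sqrt h2
  rw [Real.sqrt_mul h2, div_mul_eq_mul_div, div_eq_iff h1.ne']
  linear_combination (-Real.sqrt (n - i)) * h - Real.sqrt (n.choose i) * h3

theorem sqrt_choose_succ_div (n i : ℕ) (hi : i < n) :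
    Real.sqrt (n.choose (i + 1)) / Real.sqrt (n.choose i) * (i + 1) =
      Real.sqrt ((n - i) * (i + 1)) := by
  have h := sqrt_choose_succ n i hi
  have h1 : 0 < Real.sqrt (n.choose i) :=
    Real.sqrt_pos.2 (by exact_mod_cast Nat.choose_pos (by omega))
  have h2 : (0 : ℝ) ≤ n - i := sub_nonneg.2 (by exact_mod_cast hi.le)
  have h3 := Real.mul_self_sqrt (show (0 : ℝ) ≤ i + 1 by positivity)
  rw [Real.sqrt_mul h2, div_mul_eq_mul_div, div_eq_iff h1.ne']
  linear_combination (Real.sqrt (i + 1)) * h - Real.sqrt (n.choose (i + 1)) * h3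

/-- The left side is what the product rule gives for an entry of `spinMatrix` at the identity; only
the diagonal and its two neighbours contribute. -/
theorem dspin_apply (n : ℕ) (X : Matrix (Fin 2) (Fin 2) ℂ) (k i : Fin (n + 1)) :
    ((Real.sqrt (n.choose i) / Real.sqrt (n.choose k) : ℝ) : ℂ) *
      ((((n - i : ℕ) : Polynomial ℂ) * 1 ^ (n - i - 1) *
        (Polynomial.C (X 0 0) + Polynomial.C (X 1 0) * Polynomial.X)) * Polynomial.X ^ (i : ℕ) +
        1 ^ (n - i) * (((i : ℕ) : Polynomial ℂ) * Polynomial.X ^ ((i : ℕ) - 1) *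
          (Polynomial.C (X 0 1) + Polynomial.C (X 1 1) * Polynomial.X)) :
          Polynomial ℂ).coeff k = dspin n X k i := by
  have hp : ((((n - i : ℕ) : Polynomial ℂ) * 1 ^ (n - i - 1) *
        (Polynomial.C (X 0 0) + Polynomial.C (X 1 0) * Polynomial.X)) * Polynomial.X ^ (i : ℕ) +
        1 ^ (n - i) * (((i : ℕ) : Polynomial ℂ) * Polynomial.X ^ ((i : ℕ) - 1) *
          (Polynomial.C (X 0 1) + Polynomial.C (X 1 1) * Polynomial.X)) : Polynomial ℂ) =
      Polynomial.C ((n - i : ℕ) * X 0 0 + (i : ℕ) * X 1 1) * Polynomial.X ^ (i : ℕ) +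
      Polynomial.C ((n - i : ℕ) * X 1 0) * Polynomial.X ^ ((i : ℕ) + 1) +
      Polynomial.C ((i : ℕ) * X 0 1) * Polynomial.X ^ ((i : ℕ) - 1) := by
    simp only [one_pow, map_add, map_mul, Polynomial.C_eq_natCast]
    rcases (i : ℕ) with _ | i
    · simp
      ring
    · simp only [Nat.add_sub_cancel]
      ring
  have hc : ((n - i : ℕ) : ℂ) = n - (i : ℕ) := Nat.cast_sub (by omega)
  rw [hp]
  simp only [Polynomial.coeff_add, Polynomial.coeff_C_mul, Polynomial.coeff_X_pow, dspin, Jz,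
    Matrix.add_apply, Matrix.smul_apply, Jplus_apply, Jminus_apply, Matrix.one_apply,
    Matrix.diagonal_apply, smul_eq_mul]
  by_cases h0 : k = i
  · subst h0
    have hk : Real.sqrt (n.choose k) ≠ 0 :=
      (Real.sqrt_pos.2 (by exact_mod_cast Nat.choose_pos (by omega))).ne'
    rw [div_self hk, hc]
    by_cases h1 : (k : ℕ) = 0
    · simp [h1]
      ring
    · rw [if_pos rfl, if_neg (c := (k : ℕ) = k + 1) (by omega),
        if_neg (c := (k : ℕ) = k - 1) (by omega), if_pos rfl, if_pos rfl]
      simp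
      ring
  · have h0' : (k : ℕ) ≠ i := fun h => h0 (Fin.ext h)
    rw [if_neg h0', if_neg h0, if_neg h0]
    by_cases h1 : (k : ℕ) = i + 1
    · have h2 := sqrt_choose_div_succ n i (by omega)
      rw [if_pos h1, if_neg (c := (k : ℕ) = i - 1) (by omega),
        if_neg (c := (i : ℕ) = k + 1) (by omega), if_pos h1, h1, hc, ← h2]
      push_cast
      ring
    · rw [if_neg h1, if_neg h1]
      by_cases h3 : (i : ℕ) = k + 1
      · have h2 := sqrt_choose_succ_div n k (by omega)
        rw [if_pos (c := (k : ℕ) = i - 1) (by omega), if_pos h3, h3, ← h2]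
        push_cast
        ring
      · by_cases h4 : (i : ℕ) = 0
        · simp [h4]
        · rw [if_neg h3, if_neg (by omega)]
          simp

theorem hasDerivAt_spinMatrix (n : ℕ) {γ : ℝ → Matrix (Fin 2) (Fin 2) ℂ}
    {X : Matrix (Fin 2) (Fin 2) ℂ} (h0 : γ 0 = 1)
    (hγ : ∀ a b, HasDerivAt (fun t => γ t a b) (X a b) 0) (k i : Fin (n + 1)) :
    HasDerivAt (fun t => spinMatrix n (γ t) k i) (dspin n X k i) 0 := by
  have h := (((coeffHasDerivAt_linear (hγ 0 0) (hγ 1 0)).pow (n - i)).mul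
    ((coeffHasDerivAt_linear (hγ 0 1) (hγ 1 1)).pow i)) k
  rw [← dspin_apply]
  simp only [spinMatrix, Matrix.of_apply, spinPoly]
  refine HasDerivAt.const_mul _ ?_
  simpa [h0] using h

theorem hasDerivAt_mul_apply {n : ℕ} {M : ℝ → Op n} {M' : Op n}
    (hM : ∀ k i, HasDerivAt (fun t => M t k i) (M' k i) 0) (A : Op n) (k i : Fin (n + 1)) :
    HasDerivAt (fun t => (M t * A) k i) ((M' * A) k i) 0 := by
  simp only [Matrix.mul_apply]
  exact HasDerivAt.fun_sum fun m _ => (hM k m).mul_const _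

theorem hasDerivAt_const_mul_apply {n : ℕ} {M : ℝ → Op n} {M' : Op n}
    (hM : ∀ k i, HasDerivAt (fun t => M t k i) (M' k i) 0) (A : Op n) (k i : Fin (n + 1)) :
    HasDerivAt (fun t => (A * M t) k i) ((A * M') k i) 0 := by
  simp only [Matrix.mul_apply]
  exact HasDerivAt.fun_sum fun m _ => (hM m i).const_mul _

/-- Differentiate the image of g(1 + tX) = (1 + tY)g at t = 0. Straight lines suffice as curves
because `spinMatrix` is multiplicative beyond SU(2). -/
theorem spinMatrix_mul_dspin (n : ℕ) {g X Y : Matrix (Fin 2) (Fin 2) ℂ} (hg : g.det ≠ 0)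
    (h : g * X = Y * g) : spinMatrix n g * dspin n X = dspin n Y * spinMatrix n g := by
  have hd (Z : Matrix (Fin 2) (Fin 2) ℂ) (k i : Fin (n + 1)) :
      HasDerivAt (fun t : ℝ => spinMatrix n (1 + (t : ℂ) • Z) k i) (dspin n Z k i) 0 := by
    refine hasDerivAt_spinMatrix n (γ := fun t : ℝ => 1 + (t : ℂ) • Z) (by simp) ?_ k i
    intro a b
    simp only [Matrix.add_apply, Matrix.smul_apply, smul_eq_mul]
    have h1 := ((Complex.ofRealCLM.hasDerivAt (x := (0 : ℝ))).mul_const (Z a b)).const_add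
      ((1 : Matrix (Fin 2) (Fin 2) ℂ) a b)
    simpa using h1
  -- `spinMatrix_mul` asks for an invertible left factor, available for small t.
  have hdet : ∀ᶠ t : ℝ in nhds 0, (1 + (t : ℂ) • Y).det ≠ 0 := by
    have hc : Continuous fun t : ℝ => (1 + (t : ℂ) • Y).det := by
      apply Continuous.matrix_det
      fun_prop
    apply hc.continuousAt.eventually_ne
    simp
  ext k i
  refine (hasDerivAt_const_mul_apply (hd X) (spinMatrix n g) k i).unique ?_
  refine (hasDerivAt_mul_apply (hd Y) (spinMatrix n g) k i).congr_of_eventuallyEq ?_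
  filter_upwards [hdet] with t ht
  rw [← spinMatrix_mul n _ _ hg, ← spinMatrix_mul n _ _ ht, mul_add, add_mul, mul_smul_comm,
    smul_mul_assoc, h, mul_one, one_mul]

theorem spinRep_apply (n : ℕ) (g : SU2) : spinRep n g = spinMatrix n g.1 := rfl

theorem SU2.det_eq_one (g : SU2) : g.1.det = 1 := (Matrix.mem_specialUnitaryGroup_iff.1 g.2).2

theorem spinRep_mul_inv (n : ℕ) (g : SU2) : spinRep n g * spinRep n g⁻¹ = 1 := by
  rw [← map_mul, mul_inv_cancel, map_one]

theorem spinRep_inv_mul (n : ℕ) (g : SU2) : spinRep n g⁻¹ * spinRep n g = 1 := by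
  rw [← map_mul, inv_mul_cancel, map_one]

theorem opAct_eq_of_semiconjBy {n : ℕ} {g : SU2} {A B : Op n}
    (h : SemiconjBy (spinRep n g) A B) : opAct n g A = B := by
  rw [opAct, h.eq, mul_assoc, spinRep_mul_inv, mul_one]

/-! ### Coherent vectors -/

/-- The vector `(e₁ + b e₂)^n`. -/
def coherent (n : ℕ) (b : ℂ) : Fin (n + 1) → ℂ := fun k => (Real.sqrt (n.choose k) : ℂ) * b ^ (k : ℕ)

/-- Binomial expansion of (g e₁ + b g e₂)^n: the reason why g permutes the coherent vectors up to
scalars. -/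
theorem sum_choose_mul_spinPoly (n : ℕ) (g : Matrix (Fin 2) (Fin 2) ℂ) (b : ℂ) :
    ∑ i ∈ Finset.range (n + 1), Polynomial.C ((n.choose i : ℂ) * b ^ i) * spinPoly n g i =
      (Polynomial.C (g 0 0 + g 0 1 * b) + Polynomial.C (g 1 0 + g 1 1 * b) * Polynomial.X) ^ n := by
  have h : Polynomial.C (g 0 0 + g 0 1 * b) + Polynomial.C (g 1 0 + g 1 1 * b) * Polynomial.X =
      Polynomial.C b * (Polynomial.C (g 0 1) + Polynomial.C (g 1 1) * Polynomial.X) +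
        (Polynomial.C (g 0 0) + Polynomial.C (g 1 0) * Polynomial.X) := by
    simp only [map_add, map_mul]
    ring
  rw [h, add_pow]
  refine Finset.sum_congr rfl fun i _ => ?_
  rw [spinPoly, mul_pow, map_mul, map_pow, Polynomial.C_eq_natCast]
  ring

theorem coeff_linear_pow (a b : ℂ) (n k : ℕ) :
    ((Polynomial.C a + Polynomial.C b * Polynomial.X) ^ n).coeff k =
      n.choose k * a ^ (n - k) * b ^ k := by
  rw [add_comm, add_pow, Polynomial.finsetSum_coeff]
  have h (m : ℕ) : ((Polynomial.C b * Polynomial.X) ^ m * Polynomial.C a ^ (n - m) *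
      (n.choose m : Polynomial ℂ)).coeff k =
      if k = m then n.choose m * a ^ (n - m) * b ^ m else 0 := by
    have : (Polynomial.C b * Polynomial.X) ^ m * Polynomial.C a ^ (n - m) *
        (n.choose m : Polynomial ℂ) =
        Polynomial.C (n.choose m * a ^ (n - m) * b ^ m) * Polynomial.X ^ m := by
      simp only [map_mul, map_pow, Polynomial.C_eq_natCast]
      ring
    rw [this, Polynomial.coeff_C_mul, Polynomial.coeff_X_pow, mul_ite, mul_one, mul_zero]
  simp only [h, Finset.sum_ite_eq, Finset.mem_range]
  split_ifs with hk
  · rfl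
  · rw [Nat.choose_eq_zero_of_lt (by omega)]
    simp

theorem spinMatrix_mulVec_coherent (n : ℕ) (g : Matrix (Fin 2) (Fin 2) ℂ) (b : ℂ)
    (h : g 0 0 + g 0 1 * b ≠ 0) : spinMatrix n g *ᵥ coherent n b =
      (g 0 0 + g 0 1 * b) ^ n •
        coherent n ((g 1 0 + g 1 1 * b) / (g 0 0 + g 0 1 * b)) := by
  ext k
  have hs (i : Fin (n + 1)) : (Real.sqrt (n.choose i) : ℂ) ≠ 0 := by
    rw [Complex.ofReal_ne_zero]
    exact (Real.sqrt_pos.2 (by exact_mod_cast Nat.choose_pos (by omega))).ne'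
  have hss (i : Fin (n + 1)) :
      (Real.sqrt (n.choose i) : ℂ) * (Real.sqrt (n.choose i) : ℂ) = (n.choose i : ℂ) := by
    rw [ofReal_sqrt_mul_self (by positivity)]
    simp
  have h1 := congrArg (fun p => Polynomial.coeff p k) (sum_choose_mul_spinPoly n g b)
  simp only [Polynomial.finsetSum_coeff, Polynomial.coeff_C_mul, coeff_linear_pow] at h1
  rw [Finset.sum_range] at h1
  have h2 : (spinMatrix n g *ᵥ coherent n b) k = (Real.sqrt (n.choose k) : ℂ)⁻¹ *
      ∑ i : Fin (n + 1), (n.choose i : ℂ) * b ^ (i : ℕ) * (spinPoly n g i).coeff k := by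
    rw [Matrix.mulVec, dotProduct, Finset.mul_sum]
    refine Finset.sum_congr rfl fun i _ => ?_
    rw [spinMatrix, Matrix.of_apply, coherent, ← hss i]
    push_cast
    ring
  have hp : (g 0 0 + g 0 1 * b) ^ n = (g 0 0 + g 0 1 * b) ^ (n - k : ℕ) *
      (g 0 0 + g 0 1 * b) ^ (k : ℕ) := by rw [← pow_add, Nat.sub_add_cancel (by omega)]
  rw [h2, h1, Pi.smul_apply, coherent, smul_eq_mul, hp, div_pow, ← hss k]
  field_simp [hs k]

/-- A functional evaluated on `coherent n b` is a polynomial in b; if it vanishes on an infinite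
set, all its coefficients vanish. -/
theorem span_coherent_eq_top (n : ℕ) (s : Set ℂ) (hs : s.Infinite) :
    Submodule.span ℂ (coherent n '' s) = ⊤ := by
  by_contra h
  obtain ⟨f, hf, hle⟩ := Submodule.exists_le_ker_of_lt_top _ (lt_top_iff_ne_top.2 h)
  apply hf
  set p : Polynomial ℂ := ∑ k : Fin (n + 1),
    Polynomial.C (f (Pi.single k 1) * (Real.sqrt (n.choose k) : ℂ)) * Polynomial.X ^ (k : ℕ) with hp
  have hev (b : ℂ) : p.eval b = f (coherent n b) := by
    rw [LinearMap.pi_apply_eq_sum_univ f, hp, Polynomial.eval_finsetSum]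
    refine Finset.sum_congr rfl fun k _ => ?_
    have : (fun j => if k = j then (1 : ℂ) else 0) = Pi.single k 1 := by
      ext j
      simp [Pi.single_apply, eq_comm]
    rw [this]
    simp [coherent]
    ring
  have hp0 : p = 0 := by
    apply Polynomial.eq_zero_of_infinite_isRoot
    refine hs.mono fun b hb => ?_
    rw [Set.mem_ofPred_eq, Polynomial.IsRoot, hev]
    exact hle (Submodule.subset_span ⟨b, hb, rfl⟩)
  refine LinearMap.pi_ext' fun k => ?_
  ext
  have hk := congrArg (fun q => Polynomial.coeff q k) hp0
  simp only [hp, Polynomial.finsetSum_coeff, Polynomial.coeff_C_mul, Polynomial.coeff_X_pow,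
    Polynomial.coeff_zero] at hk
  rw [Finset.sum_eq_single k] at hk
  · have h1 : (Real.sqrt (n.choose k) : ℂ) ≠ 0 := by
      rw [Complex.ofReal_ne_zero]
      exact (Real.sqrt_pos.2 (by exact_mod_cast Nat.choose_pos (by omega))).ne'
    simpa [h1] using hk
  · intro j _ hj
    rw [if_neg (fun h => hj (Fin.ext h.symm)), mul_zero]
  · simp

/-! ### The summands of the operator space -/

/-- The linear map from the space of `φ_l` to the operators that takes the coherent vectors to the
values of `ladderPoly n l`. -/
def ladderMap (n l : ℕ) : (Fin (2 * l + 1) → ℂ) →ₗ[ℂ] Op n :=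
  ∑ k : Fin (2 * l + 1), (LinearMap.proj k : (Fin (2 * l + 1) → ℂ) →ₗ[ℂ] ℂ).smulRight
    ((Real.sqrt ((2 * l).choose k) : ℂ)⁻¹ • (ladderPoly n l).coeff k)

theorem ladderMap_apply (n l : ℕ) (v : Fin (2 * l + 1) → ℂ) : ladderMap n l v =
    ∑ k, (v k * (Real.sqrt ((2 * l).choose k) : ℂ)⁻¹) • (ladderPoly n l).coeff k := by
  simp [ladderMap, LinearMap.sum_apply, smul_smul]

/-- The nilpotent matrix `ξ ξᵀ ε` with `ξ = (1, b)`. -/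
def nilp (b : ℂ) : Matrix (Fin 2) (Fin 2) ℂ := !![-b, 1; -b ^ 2, b]

/-- The square-root weights cancel, leaving the value of `ladderPoly n l` at b, and the quadratic J₊
- 2b J₃ - b² J₋ is the infinitesimal action of `nilp b`. -/
theorem ladderMap_coherent (n l : ℕ) (b : ℂ) :
    ladderMap n l (coherent (2 * l) b) = dspin n (nilp b) ^ l := by
  have hc (a : Op n) : Commute (RingHom.id (Op n) a) (algebraMap ℂ (Op n) b) :=
    (Algebra.commute_algebraMap_right b a)
  have h1 : Polynomial.eval₂RingHom' (RingHom.id (Op n)) (algebraMap ℂ (Op n) b) hc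
      (ladderPoly n l) = dspin n (nilp b) ^ l := by
    rw [ladderPoly, map_pow]
    congr 1
    change Polynomial.eval₂ _ _ _ = _
    simp only [Polynomial.eval₂_sub, Polynomial.eval₂_C, pow_two, ← mul_assoc,
      Polynomial.eval₂_mul_X, RingHom.id_apply, ← Algebra.commutes, ← Algebra.smul_def]
    simp only [dspin, nilp, Matrix.of_apply, Matrix.cons_val', Matrix.cons_val_zero,
      Matrix.cons_val_one, Matrix.cons_val_fin_one]
    module
  rw [← h1]
  change _ = Polynomial.eval₂ _ _ _
  rw [Polynomial.eval₂_eq_sum_range' _ (Nat.lt_succ_of_le (ladderPoly_natDegree_le n l)),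
    ladderMap_apply, Finset.sum_range]
  refine Finset.sum_congr rfl fun k _ => ?_
  have hs : (Real.sqrt ((2 * l).choose k) : ℂ) ≠ 0 := by
    rw [Complex.ofReal_ne_zero]
    exact (Real.sqrt_pos.2 (by exact_mod_cast Nat.choose_pos (by omega))).ne'
  rw [coherent, mul_right_comm, mul_inv_cancel₀ hs, one_mul, RingHom.id_apply, ← map_pow,
    ← Algebra.commutes, Algebra.smul_def]

theorem dspin_smul (n : ℕ) (c : ℂ) (X : Matrix (Fin 2) (Fin 2) ℂ) :
    dspin n (c • X) = c • dspin n X := by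
  simp only [dspin, Matrix.smul_apply, smul_eq_mul, smul_add, smul_smul]
  congr 4 <;> ring

/-- Determinant 1 means gᵀ ε g = ε, so conjugating ξ ξᵀ ε by g replaces ξ by gξ. Rescaling gξ to
first coordinate 1 produces the square. -/
theorem mul_nilp (g : SU2) (b : ℂ) (h : g.1 0 0 + g.1 0 1 * b ≠ 0) :
    g.1 * nilp b = ((g.1 0 0 + g.1 0 1 * b) ^ 2 •
      nilp ((g.1 1 0 + g.1 1 1 * b) / (g.1 0 0 + g.1 0 1 * b))) * g.1 := by
  have hd := g.det_eq_one
  rw [Matrix.det_fin_two] at hd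
  have h2 : (g.1 0 0 + g.1 0 1 * b) ^ 2 •
      nilp ((g.1 1 0 + g.1 1 1 * b) / (g.1 0 0 + g.1 0 1 * b)) =
      !![-((g.1 0 0 + g.1 0 1 * b) * (g.1 1 0 + g.1 1 1 * b)), (g.1 0 0 + g.1 0 1 * b) ^ 2;
        -(g.1 1 0 + g.1 1 1 * b) ^ 2, (g.1 0 0 + g.1 0 1 * b) * (g.1 1 0 + g.1 1 1 * b)] := by
    ext i j
    fin_cases i <;> fin_cases j <;> simp [nilp] <;> field_simp
  rw [h2]
  ext i j
  fin_cases i <;> fin_cases j <;> simp [nilp, Matrix.mul_apply, Fin.sum_univ_two]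
  · linear_combination (b * (g.1 0 0 + g.1 0 1 * b)) * hd
  · linear_combination (-(g.1 0 0 + g.1 0 1 * b)) * hd
  · linear_combination (b * (g.1 1 0 + g.1 1 1 * b)) * hd
  · linear_combination (-(g.1 1 0 + g.1 1 1 * b)) * hd

/-- `opAct` as a linear map. -/
def opActLin (n : ℕ) (g : SU2) : Op n →ₗ[ℂ] Op n :=
  LinearMap.mulRight ℂ (spinRep n g⁻¹) ∘ₗ LinearMap.mulLeft ℂ (spinRep n g)

theorem opActLin_apply (n : ℕ) (g : SU2) (A : Op n) : opActLin n g A = opAct n g A := rfl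

/-- It is enough to test coherent vectors: g moves b by the same Möbius map on both sides, with the
same scalar to the power 2l. The one b that may be sent to infinity is left out, and the others
still span. -/
theorem ladderMap_equivariant (n l : ℕ) (g : SU2) (v : Fin (2 * l + 1) → ℂ) :
    ladderMap n l (spinRep (2 * l) g *ᵥ v) = opAct n g (ladderMap n l v) := by
  have hinf : {b : ℂ | g.1 0 0 + g.1 0 1 * b ≠ 0}.Infinite := by
    have hd := g.det_eq_one
    rw [Matrix.det_fin_two] at hd
    have hb : {b : ℂ | g.1 0 0 + g.1 0 1 * b = 0}.Subsingleton := by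
      intro b hb b' hb'
      have h1 : g.1 0 0 + g.1 0 1 * b = 0 := hb
      have h2 : g.1 0 0 + g.1 0 1 * b' = 0 := hb'
      have h3 : g.1 0 1 ≠ 0 := by
        intro h0
        rw [h0, zero_mul, add_zero] at h1
        simp [h0, h1] at hd
      exact mul_left_cancel₀ h3 (by linear_combination h1 - h2)
    exact hb.finite.infinite_compl
  have key : ladderMap n l ∘ₗ Matrix.mulVecLin (spinRep (2 * l) g) =
      opActLin n g ∘ₗ ladderMap n l := by
    refine LinearMap.ext_on (span_coherent_eq_top (2 * l) _ hinf) ?_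
    rintro _ ⟨b, hb, rfl⟩
    simp only [LinearMap.comp_apply, Matrix.mulVecLin_apply, opActLin_apply]
    rw [ladderMap_coherent, spinRep_apply, spinMatrix_mulVec_coherent _ _ _ hb, map_smul,
      ladderMap_coherent]
    have h1 : SemiconjBy (spinRep n g) (dspin n (nilp b)) _ :=
      spinMatrix_mul_dspin n (by rw [g.det_eq_one]; exact one_ne_zero) (mul_nilp g b hb)
    rw [opAct_eq_of_semiconjBy (h1.pow_right l), dspin_smul, smul_pow, ← pow_mul]
  exact LinearMap.congr_fun key v

theorem ladderPoly_coeff_mem_range (n l m : ℕ) (hm : m ≤ 2 * l) :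
    (ladderPoly n l).coeff m ∈ LinearMap.range (ladderMap n l) := by
  refine ⟨Pi.single ⟨m, by omega⟩ (Real.sqrt ((2 * l).choose m) : ℂ), ?_⟩
  have hs : (Real.sqrt ((2 * l).choose m) : ℂ) ≠ 0 := by
    rw [Complex.ofReal_ne_zero]
    exact (Real.sqrt_pos.2 (by exact_mod_cast Nat.choose_pos (by omega))).ne'
  rw [ladderMap_apply, Finset.sum_eq_single ⟨m, by omega⟩]
  · simp [hs]
  · intro k _ hk
    simp [hk]
  · simp

theorem coupled_mem_range (n l : ℕ) : coupled n l ∈ LinearMap.range (ladderMap n l) := by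
  rw [coupled_eq, ad_pow_Jplus_pow]
  exact Submodule.smul_mem _ _ (Submodule.smul_mem _ _
    (ladderPoly_coeff_mem_range n l l (by omega)))

theorem coupled_mem_opSummand (n l : ℕ) : coupled n l ∈ opSummand n l :=
  Submodule.subset_span ⟨ladderMap n l, ladderMap_equivariant n l, coupled_mem_range n l⟩

/-- The orbit of `coupled n l'` stays in the range of `ladderMap n l'`, which is spanned by rungs
orthogonal to `coupled n l`. -/
theorem trace_coupled_mul_opAct_coupled {n l l' : ℕ} (h : l ≠ l') (g : SU2) :
    (coupled n l * opAct n g (coupled n l')).trace = 0 := by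
  obtain ⟨v, hv⟩ := coupled_mem_range n l'
  rw [← hv, ← ladderMap_equivariant, ladderMap_apply, Finset.mul_sum, Matrix.trace_sum]
  refine Finset.sum_eq_zero fun k _ => ?_
  have h1 := trace_coupled_mul_ad_pow_eq_zero (n := n) h k
  rw [ad_pow_Jplus_pow, mul_smul_comm, Matrix.trace_smul, smul_eq_mul] at h1
  have h2 := (mul_eq_zero.1 h1).resolve_left (by exact_mod_cast Nat.factorial_ne_zero _)
  rw [mul_smul_comm, Matrix.trace_smul, h2, smul_zero]

/-! ### Subspaces of operators stable under the ladder operators -/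

theorem Jplus_pow_apply_last (n m : ℕ) (k : Fin (n + 1)) (hk : (k : ℕ) + m = n) :
    (Jplus n ^ m) k (Fin.last n) ≠ 0 := by
  rw [Jplus_pow, Matrix.transpose_apply, Jminus_pow_apply, if_pos (by simp [hk]),
    Complex.ofReal_ne_zero]
  refine (Real.sqrt_pos.2 ?_).ne'
  have h1 : 0 < (n - (k : ℕ)).descFactorial m := Nat.descFactorial_pos.2 (by omega)
  have h2 : 0 < ((k : ℕ) + 1).ascFactorial m := Nat.ascFactorial_pos _ _
  positivity

theorem mul_Jplus_pow_apply_last {n m : ℕ} (A : Op n) (k i : Fin (n + 1)) (hi : (i : ℕ) + m = n) :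
    (A * Jplus n ^ m) k (Fin.last n) = A k i * (Jplus n ^ m) i (Fin.last n) := by
  rw [Matrix.mul_apply]
  refine Finset.sum_eq_single i (fun j _ hj => ?_) (by simp)
  rw [Jplus_pow, Matrix.transpose_apply, Jminus_pow_apply, if_neg, mul_zero]
  intro h
  exact hj (Fin.ext (by simp at h; omega))

/-- The lowest weight vector is cyclic for J₊, so a matrix commuting with J₊ is determined by its
last column. -/
theorem eq_zero_of_commute_Jplus {n : ℕ} {A : Op n} (hA : Commute A (Jplus n))
    (h0 : ∀ k, A k (Fin.last n) = 0) : A = 0 := by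
  ext k i
  have h1 := mul_Jplus_pow_apply_last (m := n - i) A k i (by omega)
  have h2 : (Jplus n ^ (n - i : ℕ) * A) k (Fin.last n) = 0 := by
    rw [Matrix.mul_apply]
    exact Finset.sum_eq_zero fun j _ => by rw [h0, mul_zero]
  rw [(hA.pow_right _).eq, h2] at h1
  exact (mul_eq_zero.1 h1.symm).resolve_right (Jplus_pow_apply_last n _ i (by omega))

/-- The commutant of `J₊` consists of the polynomials in `J₊`. -/
theorem exists_eq_sum_Jplus_pow {n : ℕ} {A : Op n} (hA : Commute A (Jplus n)) :
    ∃ a : ℕ → ℂ, A = ∑ l ∈ Finset.range (n + 1), a l • Jplus n ^ l := by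
  -- The last column of J₊^l has its only nonzero entry in row n - l, so the coefficients are read
  -- off the last column of A.
  refine ⟨fun l => A (Fin.ofNat (n + 1) (n - l)) (Fin.last n) /
    (Jplus n ^ l) (Fin.ofNat (n + 1) (n - l)) (Fin.last n), sub_eq_zero.1 ?_⟩
  refine eq_zero_of_commute_Jplus (hA.sub_left (Commute.sum_left _ _ _ fun l _ =>
    ((Commute.refl (Jplus n)).pow_left l).smul_left _)) fun k => ?_
  rw [Matrix.sub_apply, Matrix.sum_apply, Finset.sum_eq_single (n - k : ℕ)]
  · have hk : Fin.ofNat (n + 1) (n - (n - k : ℕ)) = k := by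
      ext
      rw [Fin.val_ofNat, Nat.mod_eq_of_lt (by omega)]
      omega
    rw [Matrix.smul_apply, smul_eq_mul]
    beta_reduce
    rw [hk, div_mul_cancel₀ _ (Jplus_pow_apply_last n _ k (by omega)), sub_self]
  · intro l hl hlk
    have := Finset.mem_range.1 hl
    rw [Matrix.smul_apply, Jplus_pow, Matrix.transpose_apply, Jminus_pow_apply, if_neg, smul_zero]
    intro h
    simp only [Fin.val_last] at h
    omega
  · intro h
    exact absurd (Finset.mem_range.2 (by omega)) h

/-- Write A as a polynomial in J₊ and let l be its degree. Lowering 2l times kills the smaller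
powers and turns J₊^l into a nonzero multiple of J₋^l. -/
theorem exists_ad_pow_eq_of_commute {n : ℕ} {A : Op n} (hA : Commute A (Jplus n)) (h0 : A ≠ 0) :
    ∃ l ≤ n, ∃ c : ℂ, c ≠ 0 ∧ (ad (Jminus n) ^ (2 * l)) A = c • Jminus n ^ l ∧
      (l = 0 → A = c • 1) := by
  obtain ⟨a, ha⟩ := exists_eq_sum_Jplus_pow hA
  have hne : ((Finset.range (n + 1)).filter fun l => a l ≠ 0).Nonempty := by
    by_contra hemp
    rw [Finset.not_nonempty_iff_eq_empty, Finset.filter_eq_empty_iff] at hemp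
    apply h0
    rw [ha]
    refine Finset.sum_eq_zero fun l hl => ?_
    rw [not_not.1 (hemp hl), zero_smul]
  obtain ⟨l, hl, hmax⟩ := Finset.exists_max_image _ id hne
  rw [Finset.mem_filter, Finset.mem_range] at hl
  have hmax' : ∀ m ∈ Finset.range (n + 1), l < m → a m = 0 := by
    intro m hm hlm
    by_contra h
    have := hmax m (Finset.mem_filter.2 ⟨hm, h⟩)
    simp only [id] at this
    omega
  have hpow : (ad (Jminus n) ^ (2 * l)) A =
      (a l * ((-1) ^ l * ((2 * l).factorial : ℂ))) • Jminus n ^ l := by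
    rw [ha, map_sum, Finset.sum_eq_single l]
    · rw [map_smul, ad_pow_Jplus_pow_two_mul, smul_smul]
    · intro m hm hml
      rcases lt_or_gt_of_ne hml with h | h
      · rw [map_smul, ad_pow_Jplus_pow_eq_zero n m (2 * l) (by omega), smul_zero]
      · rw [hmax' m hm h, zero_smul, map_zero]
    · intro h
      exact absurd (Finset.mem_range.2 hl.1) h
  refine ⟨l, by omega, _, mul_ne_zero hl.2 (mul_ne_zero (pow_ne_zero _ (by norm_num))
    (by exact_mod_cast Nat.factorial_ne_zero _)), hpow, ?_⟩
  rintro rfl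
  simpa using hpow

theorem Jminus_pow_ne_zero {n l : ℕ} (hl : l ≤ n) : Jminus n ^ l ≠ 0 := by
  intro h
  have h1 := Jplus_pow_apply_last n l ⟨n - l, by omega⟩ (by simp; omega)
  rw [Jplus_pow, h] at h1
  exact h1 rfl

/-- Infinitesimal Schur lemma: a positive degree in J₊ would make an iterated lowering of A nonzero,
while a single one already kills A. -/
theorem eq_smul_one_of_commute {n : ℕ} {A : Op n} (h₁ : ad (Jplus n) A = 0)
    (h₂ : ad (Jminus n) A = 0) : ∃ c : ℂ, A = c • 1 := by
  by_cases h0 : A = 0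
  · exact ⟨0, by simp [h0]⟩
  obtain ⟨l, hl, c, hc, h, hl0⟩ := exists_ad_pow_eq_of_commute (sub_eq_zero.1 h₁).symm h0
  rcases l with _ | l
  · exact ⟨c, hl0 rfl⟩
  · rw [mul_add, mul_one, pow_succ, Module.End.mul_apply, h₂, map_zero] at h
    exact absurd h.symm (smul_ne_zero hc (Jminus_pow_ne_zero hl))

theorem ad_pow_mem {n : ℕ} {J : Op n} {Q : Submodule ℂ (Op n)} (h : ∀ A ∈ Q, ad J A ∈ Q)
    {A : Op n} (hA : A ∈ Q) (m : ℕ) : (ad J ^ m) A ∈ Q := by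
  induction m with
  | zero => exact hA
  | succ m ih =>
    rw [pow_succ', Module.End.mul_apply]
    exact h _ ih

theorem isNilpotent_ad_Jplus (n : ℕ) : IsNilpotent (ad (Jplus n)) := by
  have h : IsNilpotent (Jplus n) := ⟨n + 1, Jplus_pow_eq_zero n⟩
  exact (LinearMap.commute_mulLeft_right (Jplus n) (Jplus n)).isNilpotent_sub
    ((LinearMap.isNilpotent_mulLeft_iff ℂ _).2 h) ((LinearMap.isNilpotent_mulRight_iff ℂ _).2 h)

/-- Raise a nonzero element until the next raising would kill it; lower the result 2l times to reach
J₋^l alone; raise that 2l times to J₊^l, then lower l times. -/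
theorem exists_coupled_mem {n : ℕ} {Q : Submodule ℂ (Op n)} (hQ : Q ≠ ⊥)
    (hp : ∀ A ∈ Q, ad (Jplus n) A ∈ Q) (hm : ∀ A ∈ Q, ad (Jminus n) A ∈ Q) :
    ∃ l ≤ n, coupled n l ∈ Q := by
  classical
  obtain ⟨P, hPQ, hP0⟩ := Submodule.exists_mem_ne_zero_of_ne_bot hQ
  have hex : ∃ m, (ad (Jplus n) ^ m) P = 0 := by
    obtain ⟨m, h⟩ := isNilpotent_ad_Jplus n
    exact ⟨m, by rw [h, LinearMap.zero_apply]⟩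
  obtain ⟨m, hmeq⟩ : ∃ m, Nat.find hex = m + 1 := Nat.exists_eq_succ_of_ne_zero (by
    intro h
    have := Nat.find_spec hex
    rw [h] at this
    exact hP0 this)
  have hA0 : (ad (Jplus n) ^ m) P ≠ 0 := Nat.find_min hex (by omega)
  have hA1 : ad (Jplus n) ((ad (Jplus n) ^ m) P) = 0 := by
    rw [← Module.End.mul_apply, ← pow_succ', ← hmeq]
    exact Nat.find_spec hex
  obtain ⟨l, hl, c, hc, h, -⟩ := exists_ad_pow_eq_of_commute (sub_eq_zero.1 hA1).symm hA0
  refine ⟨l, hl, ?_⟩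
  have h1 : c • Jminus n ^ l ∈ Q := h ▸ ad_pow_mem hm (ad_pow_mem hp hPQ m) _
  have h2 : Jminus n ^ l ∈ Q := (Submodule.smul_mem_iff _ hc).1 h1
  have h3 := ad_pow_mem hp h2 (2 * l)
  rw [ad_Jplus_pow_Jminus_pow_two_mul, Submodule.smul_mem_iff _ (mul_ne_zero
    (pow_ne_zero _ (by norm_num)) (by exact_mod_cast Nat.factorial_ne_zero _))] at h3
  rw [coupled_eq]
  exact Submodule.smul_mem _ _ (ad_pow_mem hm h3 l)

/-! ### Expansion of diagonal matrices -/

theorem sum_coupledDiag_mul {n : ℕ} (l l' : Fin (n + 1)) :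
    ∑ i, coupledDiag n l i * coupledDiag n l' i = if l = l' then 1 else 0 := by
  have h : (coupled n l * coupled n l').trace =
      ((∑ i, coupledDiag n l i * coupledDiag n l' i : ℝ) : ℂ) := by
    rw [coupled_eq_diagonal, coupled_eq_diagonal, Matrix.diagonal_mul_diagonal,
      Matrix.trace_diagonal]
    push_cast
    rfl
  split_ifs with hl
  · subst hl
    rw [trace_coupled_mul_self (by omega)] at h
    exact_mod_cast h.symm
  · rw [trace_coupled_mul_coupled_of_ne (fun h => hl (Fin.ext h))] at h
    exact_mod_cast h.symm

/-- The n + 1 orthonormal diagonals are the rows of a square real matrix, hence of an orthogonal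
one; the coefficients are the inner products with d. -/
theorem exists_diagonal_eq_sum_coupled {n : ℕ} (d : Fin (n + 1) → ℝ) :
    ∃ κ : Fin (n + 1) → ℝ,
      (Matrix.diagonal fun i => (d i : ℂ) : Op n) = ∑ l, (κ l : ℂ) • coupled n l := by
  set M : Matrix (Fin (n + 1)) (Fin (n + 1)) ℝ := Matrix.of fun l i => coupledDiag n l i with hM
  have h1 : M * Mᵀ = 1 := by
    ext l l'
    rw [Matrix.mul_apply, Matrix.one_apply]
    exact sum_coupledDiag_mul l l'
  have h2 : Mᵀ * M = 1 := mul_eq_one_comm.1 h1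
  refine ⟨M *ᵥ d, ?_⟩
  have h3 : d = Mᵀ *ᵥ (M *ᵥ d) := by rw [Matrix.mulVec_mulVec, h2, Matrix.one_mulVec]
  ext k i
  rw [Matrix.sum_apply]
  simp only [Matrix.smul_apply, coupled_eq_diagonal n, Matrix.diagonal_apply]
  split_ifs with hk
  · have h4 := congrFun h3 k
    rw [Matrix.mulVec, dotProduct] at h4
    rw [h4]
    push_cast
    refine Finset.sum_congr rfl fun l _ => ?_
    rw [smul_eq_mul, mul_comm]
    rfl
  · simp

theorem trace_coupled_mul_sum {n : ℕ} (κ : Fin (n + 1) → ℝ) (l : Fin (n + 1)) :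
    (coupled n l * ∑ l' : Fin (n + 1), (κ l' : ℂ) • coupled n l').trace = κ l := by
  rw [Finset.mul_sum, Matrix.trace_sum, Finset.sum_eq_single l]
  · rw [mul_smul_comm, Matrix.trace_smul, trace_coupled_mul_self (by omega), smul_eq_mul, mul_one]
  · intro l' _ h
    rw [mul_smul_comm, Matrix.trace_smul,
      trace_coupled_mul_coupled_of_ne (fun h' => h (Fin.ext h'.symm)), smul_zero]
  · simp

/-! ### Coefficients of the kernel matrices -/

/-- The coefficients of `kernelMatrix n c` with respect to the matrices `coupled n l`. -/
def kernelCoeff (n : ℕ) (c : Fin n → ℝ) : Fin (n + 1) → ℝ :=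
  Fin.cons (Real.sqrt (1 / (n + 1)))
    fun i => c i * Real.sqrt ((2 * ((i : ℕ) + 1) + 1) / (n + 1))

theorem kernelMatrix_eq_sum (n : ℕ) (c : Fin n → ℝ) :
    kernelMatrix n c = ∑ l : Fin (n + 1), (kernelCoeff n c l : ℂ) • coupled n l := by
  rw [Fin.sum_univ_succ, kernelMatrix]
  congr 1
  rw [kernelCoeff, Fin.cons_zero, Fin.val_zero, coupled_zero, smul_smul,
    ofReal_sqrt_mul_self (by positivity)]
  push_cast
  rfl

theorem kernelCoeff_succ_pos (n : ℕ) (i : Fin n) :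
    0 < Real.sqrt ((2 * ((i : ℕ) + 1) + 1) / (n + 1) : ℝ) :=
  Real.sqrt_pos.2 (by positivity)

theorem kernelCoeff_ne_zero {n : ℕ} {c : Fin n → ℝ} (hc : ∀ i, c i ≠ 0) (l : Fin (n + 1)) :
    kernelCoeff n c l ≠ 0 := by
  refine Fin.cases ?_ (fun i => ?_) l
  · exact (Real.sqrt_pos.2 (by positivity)).ne'
  · exact mul_ne_zero (hc i) (kernelCoeff_succ_pos n i).ne'

theorem trace_coupled_mul_kernelMatrix (n : ℕ) (c : Fin n → ℝ) (l : Fin (n + 1)) :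
    (coupled n l * kernelMatrix n c).trace = kernelCoeff n c l := by
  rw [kernelMatrix_eq_sum, trace_coupled_mul_sum]

theorem kernelMatrix_injective (n : ℕ) : Function.Injective (kernelMatrix n) := by
  intro c c' h
  ext i
  have h1 := trace_coupled_mul_kernelMatrix n c i.succ
  rw [h, trace_coupled_mul_kernelMatrix, Complex.ofReal_inj] at h1
  exact (mul_right_cancel₀ (kernelCoeff_succ_pos n i).ne' h1).symm

theorem trace_kernelMatrix (n : ℕ) (c : Fin n → ℝ) : (kernelMatrix n c).trace = 1 := by
  have h1 : (n + 1 : ℂ) ≠ 0 := by exact_mod_cast Nat.succ_ne_zero n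
  rw [kernelMatrix, Matrix.trace_add, Matrix.trace_sum, Finset.sum_eq_zero, add_zero,
    Matrix.trace_smul, Matrix.trace_one]
  · simp [h1]
  · intro i _
    rw [Matrix.trace_smul, trace_coupled (by omega), smul_zero]

theorem kernelMatrix_eq_diagonal (n : ℕ) (c : Fin n → ℝ) :
    ∃ d : Fin (n + 1) → ℝ, kernelMatrix n c = Matrix.diagonal fun i => (d i : ℂ) := by
  refine ⟨fun i => ∑ l : Fin (n + 1), kernelCoeff n c l * coupledDiag n l i, ?_⟩
  rw [kernelMatrix_eq_sum]
  ext k i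
  rw [Matrix.sum_apply]
  simp only [Matrix.smul_apply, coupled_eq_diagonal n, Matrix.diagonal_apply]
  split_ifs with hk
  · push_cast
    rfl
  · simp

end SpinJ

end

/-! ### Rotation invariance of the surface measure -/

noncomputable section

open scoped Pointwise in
/-- A linear isometry preserves the surface measure of the unit sphere. -/
theorem LinearIsometryEquiv.measurePreserving_toSphere {E : Type*} [NormedAddCommGroup E]
    [InnerProductSpace ℝ E] [FiniteDimensional ℝ E] [MeasurableSpace E] [BorelSpace E]
    (L : E ≃ₗᵢ[ℝ] E) (f : Metric.sphere (0 : E) 1 → Metric.sphere (0 : E) 1)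
    (hf : ∀ x, (f x : E) = L x) :
    MeasureTheory.MeasurePreserving f (MeasureTheory.volume : MeasureTheory.Measure E).toSphere
      (MeasureTheory.volume : MeasureTheory.Measure E).toSphere := by
  have hfc : Continuous f := by
    rw [Topology.IsEmbedding.subtypeVal.continuous_iff]
    have : Subtype.val ∘ f = fun x : Metric.sphere (0 : E) 1 => L x := funext hf
    rw [this]
    exact L.continuous.comp continuous_subtype_val
  refine ⟨hfc.measurable, ?_⟩
  ext s hs
  have hm (T : Set E) : MeasureTheory.volume (L ⁻¹' T) = MeasureTheory.volume T :=
    L.measurePreserving.measure_preimage_emb L.toHomeomorph.measurableEmbedding T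
  rw [MeasureTheory.Measure.map_apply hfc.measurable hs,
    MeasureTheory.Measure.toSphere_apply' _ (hfc.measurable hs),
    MeasureTheory.Measure.toSphere_apply' _ hs,
    ← hm (Set.Ioo (0 : ℝ) 1 • (Subtype.val '' s))]
  -- The measure of s is a multiple of the volume of the cone (0,1)·s, so it remains to see that L
  -- pulls this cone back to the cone over the preimage of s.
  congr 2
  ext y
  simp only [Set.mem_smul, Set.mem_image, Set.mem_preimage]
  constructor
  · rintro ⟨r, hr, _, ⟨x, hx, rfl⟩, rfl⟩
    exact ⟨r, hr, _, ⟨f x, hx, rfl⟩, by rw [hf]; exact (L.map_smul r (x : E)).symm⟩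
  · rintro ⟨r, hr, _, ⟨x, hx, rfl⟩, h⟩
    refine ⟨r, hr, _, ⟨⟨L.symm x, by simp⟩, ?_, rfl⟩, ?_⟩
    · convert hx
      ext1
      rw [hf]
      simp
    · apply L.injective
      rw [map_smul]
      simpa using h

namespace SpinJ

/-! ### Rotations -/

theorem pauli_injective : Function.Injective pauli := by
  intro x y h
  rw [pauli_eq, pauli_eq] at h
  have h0 := congrFun (congrFun h 1) 0
  have h2 := congrFun (congrFun h 0) 0
  simp only [Matrix.of_apply, Matrix.cons_val', Matrix.cons_val_zero, Matrix.cons_val_one,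
    Matrix.cons_val_fin_one] at h0 h2
  have e0 := congrArg Complex.re h0
  have e1 := congrArg Complex.im h0
  have e2 := Complex.ofReal_injective h2
  simp at e0 e1
  ext i
  fin_cases i
  · exact e0
  · exact e1
  · exact e2

theorem pauli_add (x y : E3) : pauli (x + y) = pauli x + pauli y := by
  simp only [pauli, PiLp.add_apply, Complex.ofReal_add]
  module

theorem pauli_smul (r : ℝ) (x : E3) : pauli (r • x) = (r : ℂ) • pauli x := by
  simp only [pauli, PiLp.smul_apply, smul_eq_mul, Complex.ofReal_mul]
  module

theorem SU2.star_mul_self (g : SU2) : star g.1 * g.1 = 1 :=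
  Matrix.mem_unitaryGroup_iff'.1 (Matrix.mem_specialUnitaryGroup_iff.1 g.2).1

theorem rotVec_mul (g h : SU2) (x : E3) : rotVec (g * h) x = rotVec g (rotVec h x) := by
  apply pauli_injective
  simp only [pauli_rotVec, Submonoid.coe_mul, star_mul, mul_assoc]

theorem rotVec_one (x : E3) : rotVec 1 x = x := by
  apply pauli_injective
  simp [pauli_rotVec]

theorem rot_mul (g h : SU2) (x : S2) : rot (g * h) x = rot g (rot h x) :=
  Subtype.ext (rotVec_mul g h x.1)

theorem rot_one (x : S2) : rot 1 x = x := Subtype.ext (rotVec_one x.1)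

/-- The rotation `ψ(g)` as a linear isometry. -/
def rotIsometry (g : SU2) : E3 ≃ₗᵢ[ℝ] E3 where
  toFun := rotVec g
  invFun := rotVec g⁻¹
  left_inv x := by rw [← rotVec_mul, inv_mul_cancel, rotVec_one]
  right_inv x := by rw [← rotVec_mul, mul_inv_cancel, rotVec_one]
  map_add' x y := by
    apply pauli_injective
    simp only [pauli_rotVec, pauli_add, mul_add, add_mul]
  map_smul' r x := by
    apply pauli_injective
    simp only [pauli_rotVec, pauli_smul, mul_smul_comm, smul_mul_assoc, RingHom.id_apply]
  norm_map' := norm_rotVec g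

theorem measurePreserving_rot (g : SU2) : MeasureTheory.MeasurePreserving (rot g)
    (MeasureTheory.volume : MeasureTheory.Measure E3).toSphere
    (MeasureTheory.volume : MeasureTheory.Measure E3).toSphere :=
  (rotIsometry g).measurePreserving_toSphere (rot g) fun _ => rfl

/-- The homeomorphism of `S²` given by `g ∈ SU(2)`. -/
def rotHomeo (g : SU2) : S2 ≃ₜ S2 where
  toFun := rot g
  invFun := rot g⁻¹
  left_inv x := by rw [← rot_mul, inv_mul_cancel, rot_one]
  right_inv x := by rw [← rot_mul, mul_inv_cancel, rot_one]
  continuous_toFun := by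
    rw [Topology.IsEmbedding.subtypeVal.continuous_iff]
    exact (rotIsometry g).continuous.comp continuous_subtype_val
  continuous_invFun := by
    rw [Topology.IsEmbedding.subtypeVal.continuous_iff]
    exact (rotIsometry g⁻¹).continuous.comp continuous_subtype_val

theorem integral_comp_rot (g : SU2) (f : S2 → ℂ) :
    ∫ x, f (rot g x) ∂(MeasureTheory.volume : MeasureTheory.Measure E3).toSphere =
      ∫ x, f x ∂(MeasureTheory.volume : MeasureTheory.Measure E3).toSphere :=
  (measurePreserving_rot g).integral_comp (rotHomeo g).measurableEmbedding f

theorem toSphere_real_univ :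
    (MeasureTheory.volume : MeasureTheory.Measure E3).toSphere.real Set.univ = 4 * Real.pi := by
  rw [MeasureTheory.Measure.toSphere_real_apply_univ, MeasureTheory.measureReal_def,
    EuclideanSpace.volume_ball_fin_three]
  have : 0 ≤ Real.pi * 4 / 3 := by positivity
  simp [ENNReal.toReal_ofReal this]
  ring

theorem coord_sq_sum (x : S2) : x.1 0 ^ 2 + x.1 1 ^ 2 + x.1 2 ^ 2 = 1 := by
  have h : ‖x.1‖ ^ 2 = 1 := by simp
  rw [EuclideanSpace.norm_sq_eq] at h
  simpa [Fin.sum_univ_three] using h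

theorem mem_SU2_of_normSq_add {a b : ℂ} (h : Complex.normSq a + Complex.normSq b = 1) :
    !![a, -star b; b, star a] ∈ Matrix.specialUnitaryGroup (Fin 2) ℂ := by
  have h' : a * star a + b * star b = 1 := by
    rw [Complex.star_def, Complex.mul_conj, Complex.mul_conj]
    exact_mod_cast h
  rw [Matrix.mem_specialUnitaryGroup_iff, Matrix.mem_unitaryGroup_iff]
  constructor
  · ext i j
    fin_cases i <;> fin_cases j <;>
      simp [Matrix.mul_apply, Fin.sum_univ_two, Matrix.star_apply] at h' ⊢
    · linear_combination h'
    · ring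
    · ring
    · linear_combination h'
  · rw [Matrix.det_fin_two_of]
    linear_combination h'

/-- `SU(2)` acts transitively on `S²`. -/
theorem exists_rot_northPole (x : S2) : ∃ g : SU2, rot g northPole = x := by
  have hx := coord_sq_sum x
  -- Hopf coordinates: if (a, b) is the first column of g, then g n₀ has third coordinate |a|² -
  -- |b|² and x₁ + i x₂ = 2 b ā. Off the south pole a can be taken real and positive.
  obtain ⟨a, b, h1, h2, h3⟩ : ∃ a b : ℂ, Complex.normSq a + Complex.normSq b = 1 ∧
      ((x.1 2 : ℝ) : ℂ) = a * star a - b * star b ∧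
      ((x.1 0 : ℝ) : ℂ) + (x.1 1 : ℝ) * Complex.I = 2 * b * star a := by
    by_cases hz : x.1 2 = -1
    · refine ⟨0, 1, by simp, by simp [hz], ?_⟩
      have e0 : x.1 0 = 0 := by nlinarith [sq_nonneg (x.1 0), sq_nonneg (x.1 1)]
      have e1 : x.1 1 = 0 := by nlinarith [sq_nonneg (x.1 0), sq_nonneg (x.1 1)]
      simp [e0, e1]
    · have hz' : 0 < (1 + x.1 2) / 2 := by
        have : -1 < x.1 2 := lt_of_le_of_ne (by nlinarith [sq_nonneg (x.1 0), sq_nonneg (x.1 1)])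
          (Ne.symm hz)
        linarith
      set r := Real.sqrt ((1 + x.1 2) / 2) with hr
      have hr0 : 0 < r := Real.sqrt_pos.2 hz'
      have hrr : r * r = (1 + x.1 2) / 2 := Real.mul_self_sqrt hz'.le
      have hb : Complex.normSq ⟨x.1 0 / (2 * r), x.1 1 / (2 * r)⟩ = (1 - x.1 2) / 2 := by
        rw [Complex.normSq_mk]
        field_simp
        nlinarith
      refine ⟨(r : ℂ), ⟨x.1 0 / (2 * r), x.1 1 / (2 * r)⟩, ?_, ?_, ?_⟩
      · rw [hb, Complex.normSq_ofReal, hrr]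
        ring
      · rw [Complex.star_def, Complex.mul_conj, Complex.mul_conj, hb,
          Complex.normSq_ofReal, hrr]
        push_cast
        ring
      · apply Complex.ext
        · simp
          field_simp
        · simp
          field_simp
  refine ⟨⟨_, mem_SU2_of_normSq_add h1⟩, Subtype.ext (pauli_injective ?_)⟩
  have h3' := congrArg star h3
  have h4 : ((x.1 0 : ℝ) : ℂ) - (x.1 1 : ℝ) * Complex.I = 2 * a * star b := by
    simp at h3' ⊢
    linear_combination h3'
  change pauli (rotVec _ northPole.1) = _
  rw [pauli_rotVec, pauli_eq, pauli_eq, h2, h3, h4]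
  ext i j
  fin_cases i <;> fin_cases j <;>
    simp [northPole, Matrix.mul_apply, Fin.sum_univ_two, Matrix.star_apply] <;> ring

/-- The one-parameter subgroup `exp(i t x·σ)` of `SU(2)`. -/
def circle (x : S2) (t : ℝ) : SU2 :=
  ⟨(Real.cos t : ℂ) • 1 + (Real.sin t * Complex.I : ℂ) • pauli x.1, by
    have h : (Real.cos t : ℂ) • 1 + (Real.sin t * Complex.I : ℂ) • pauli x.1 =
        !![(⟨Real.cos t, Real.sin t * x.1 2⟩ : ℂ),
          -star (⟨-(Real.sin t * x.1 1), Real.sin t * x.1 0⟩ : ℂ);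
          (⟨-(Real.sin t * x.1 1), Real.sin t * x.1 0⟩ : ℂ),
          star (⟨Real.cos t, Real.sin t * x.1 2⟩ : ℂ)] := by
      rw [pauli_eq]
      ext i j
      fin_cases i <;> fin_cases j <;> apply Complex.ext <;>
        simp [Complex.cos_ofReal_re, Complex.sin_ofReal_re]
    rw [h]
    apply mem_SU2_of_normSq_add
    rw [Complex.normSq_mk, Complex.normSq_mk]
    linear_combination Real.cos_sq_add_sin_sq t + Real.sin t ^ 2 * coord_sq_sum x⟩

theorem circle_coe (x : S2) (t : ℝ) : (circle x t).1 =
    (Real.cos t : ℂ) • 1 + (Real.sin t * Complex.I : ℂ) • pauli x.1 := rfl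

theorem star_pauli (x : E3) : star (pauli x) = pauli x := by
  rw [pauli_eq]
  ext i j
  fin_cases i <;> fin_cases j <;> (simp [Matrix.star_apply]; try ring)

theorem circle_inv (x : S2) (t : ℝ) : (circle x t)⁻¹ = circle x (-t) := by
  apply Subtype.ext
  rw [← Matrix.star_eq_inv]
  change star (circle x t).1 = _
  rw [circle_coe, circle_coe, star_add, star_smul, star_smul, star_pauli, star_one,
    star_mul', Complex.star_def, Complex.conj_ofReal, Complex.conj_ofReal, Complex.conj_I,
    Real.cos_neg, Real.sin_neg, Complex.ofReal_neg, neg_mul, mul_neg]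

theorem hasDerivAt_circle (x : S2) (a b : Fin 2) :
    HasDerivAt (fun t => (circle x t).1 a b) ((Complex.I • pauli x.1) a b) 0 := by
  have hc := (Real.hasDerivAt_cos 0).ofReal_comp
  have hs := (Real.hasDerivAt_sin 0).ofReal_comp
  have h := (hc.mul_const ((1 : Matrix (Fin 2) (Fin 2) ℂ) a b)).fun_add
    ((hs.mul_const Complex.I).mul_const (pauli x.1 a b))
  refine h.congr_deriv ?_
  simp

theorem circle_zero (x : S2) : (circle x 0).1 = 1 := by
  simp [circle_coe]

theorem hasDerivAt_spinRep_circle (n : ℕ) (x : S2) (k i : Fin (n + 1)) :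
    HasDerivAt (fun t => spinRep n (circle x t) k i) (dspin n (Complex.I • pauli x.1) k i) 0 :=
  hasDerivAt_spinMatrix n (circle_zero x) (hasDerivAt_circle x) k i

theorem hasDerivAt_spinRep_circle_inv (n : ℕ) (x : S2) (k i : Fin (n + 1)) :
    HasDerivAt (fun t => spinRep n (circle x t)⁻¹ k i)
      ((-dspin n (Complex.I • pauli x.1)) k i) 0 := by
  have h : HasDerivAt (fun t : ℝ => -t) (-1) 0 := hasDerivAt_neg 0
  have h1 := HasDerivAt.scomp_of_eq (0 : ℝ) (hasDerivAt_spinRep_circle n x k i) h (by simp)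
  simp only [circle_inv]
  refine h1.congr_deriv ?_
  simp

/-- The bridge from the group to the ladder operators: pairing with B makes the derivative scalar,
so an invariance under the group gives a vanishing commutator pairing. -/
theorem hasDerivAt_trace_opAct_circle (n : ℕ) (x : S2) (P B : Op n) :
    HasDerivAt (fun t => (opAct n (circle x t) P * B).trace)
      ((ad (dspin n (Complex.I • pauli x.1)) P * B).trace) 0 := by
  have h (t : ℝ) : (opAct n (circle x t) P * B).trace = ∑ k, ∑ m,
      (spinRep n (circle x t) * P) k m * (spinRep n (circle x t)⁻¹ * B) m k := by
    rw [opAct, mul_assoc, Matrix.trace]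
    rfl
  have h0 : spinRep n (circle x 0) = 1 := by
    rw [spinRep_apply, circle_zero, spinMatrix_one]
  have h0' : spinRep n (circle x 0)⁻¹ = 1 := by
    rw [circle_inv, neg_zero, h0]
  simp only [h]
  refine (HasDerivAt.fun_sum fun k _ => HasDerivAt.fun_sum fun m _ =>
    (hasDerivAt_mul_apply (hasDerivAt_spinRep_circle n x) P k m).fun_mul
      (hasDerivAt_mul_apply (hasDerivAt_spinRep_circle_inv n x) B m k)).congr_deriv ?_
  rw [h0, h0', one_mul, one_mul, ad_apply, sub_mul, Matrix.trace_sub]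
  simp only [Finset.sum_add_distrib]
  rw [sub_eq_add_neg, mul_assoc, mul_assoc, ← Matrix.trace_neg, ← mul_neg, ← neg_mul, ← mul_assoc]
  rfl

/-! ### Invariance under the group and under the ladder operators -/

theorem opAct_mul (n : ℕ) (g h : SU2) (A : Op n) : opAct n (g * h) A = opAct n g (opAct n h A) := by
  simp only [opAct, mul_inv_rev, map_mul, mul_assoc]

theorem opAct_one (n : ℕ) (A : Op n) : opAct n 1 A = A := by simp [opAct]

theorem trace_opAct_mul (n : ℕ) (g : SU2) (A B : Op n) :
    (opAct n g A * B).trace = (A * opAct n g⁻¹ B).trace := by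
  rw [opAct, opAct, inv_inv, mul_assoc, mul_assoc, Matrix.trace_mul_comm, mul_assoc, mul_assoc]

theorem trace_opAct (n : ℕ) (g : SU2) (A : Op n) : (opAct n g A).trace = A.trace := by
  rw [opAct, Matrix.trace_mul_comm, ← mul_assoc, spinRep_inv_mul, one_mul]

/-- The basis vectors of `ℝ³` as points of `S²`. -/
def axis (i : Fin 3) : S2 := ⟨EuclideanSpace.single i 1, by simp⟩

/-- The directions iσ₁ and iσ₂ act by i(J₊ + J₋) and J₊ - J₋, whose complex span contains J₊ and J₋.
-/
theorem ad_dspin_mem {n : ℕ} {Q : Submodule ℂ (Op n)} {A : Op n}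
    (h : ∀ x : S2, ad (dspin n (Complex.I • pauli x.1)) A ∈ Q) :
    ad (Jplus n) A ∈ Q ∧ ad (Jminus n) A ∈ Q := by
  have ad_smul (c : ℂ) (J : Op n) : ad (c • J) A = c • ad J A := by
    simp [ad_apply, smul_sub]
  have ad_add (J J' : Op n) : ad (J + J') A = ad J A + ad J' A := by
    simp only [ad_apply, add_mul, mul_add]
    abel
  have e0 : dspin n (Complex.I • pauli (axis 0).1) = Complex.I • (Jplus n + Jminus n) := by
    simp [dspin, pauli_eq, axis]
  have e1 : dspin n (Complex.I • pauli (axis 1).1) = Jplus n + (-1 : ℂ) • Jminus n := by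
    simp [dspin, pauli_eq, axis]
  have h0 := h (axis 0)
  have h1 := h (axis 1)
  rw [e0, ad_smul, Submodule.smul_mem_iff _ Complex.I_ne_zero, ad_add] at h0
  rw [e1, ad_add, ad_smul] at h1
  constructor
  · rw [← Submodule.smul_mem_iff _ (two_ne_zero (α := ℂ))]
    convert Q.add_mem h0 h1 using 1
    module
  · rw [← Submodule.smul_mem_iff _ (two_ne_zero (α := ℂ))]
    convert Q.sub_mem h0 h1 using 1
    module

theorem eq_smul_one_of_opAct_eq {n : ℕ} {A : Op n} (h : ∀ g, opAct n g A = A) :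
    ∃ c : ℂ, A = c • 1 := by
  have h1 (x : S2) : ad (dspin n (Complex.I • pauli x.1)) A ∈ (⊥ : Submodule ℂ (Op n)) := by
    rw [Submodule.mem_bot]
    refine Matrix.ext_iff_trace_mul_right.2 fun B => ?_
    have h2 := hasDerivAt_trace_opAct_circle n x A B
    simp only [h] at h2
    rw [h2.unique (hasDerivAt_const _ _), zero_mul, Matrix.trace_zero]
  exact eq_smul_one_of_commute ((Submodule.mem_bot ℂ).1 (ad_dspin_mem h1).1)
    ((Submodule.mem_bot ℂ).1 (ad_dspin_mem h1).2)

/-- The operators that are orthogonal to the orbit of `K`, with respect to the trace form. -/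
def orbitAnnihilator (n : ℕ) (K : Op n) : Submodule ℂ (Op n) where
  carrier := {P | ∀ g : SU2, (P * opAct n g K).trace = 0}
  zero_mem' g := by simp
  add_mem' {P P'} hP hP' g := by
    rw [add_mul, Matrix.trace_add, hP g, hP' g, add_zero]
  smul_mem' c P hP g := by
    rw [smul_mul_assoc, Matrix.trace_smul, hP g, smul_zero]

theorem mem_orbitAnnihilator {n : ℕ} {K P : Op n} :
    P ∈ orbitAnnihilator n K ↔ ∀ g : SU2, (P * opAct n g K).trace = 0 := Iff.rfl

/-- This is injectivity of the symbol map. The annihilator is stable under the ladder operators, so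
if nonzero it contains some `coupled n l`; at g = 1 the pairing of that matrix with the kernel is a
nonzero coefficient. -/
theorem orbitAnnihilator_eq_bot {n : ℕ} {c : Fin n → ℝ} (hc : ∀ i, c i ≠ 0) :
    orbitAnnihilator n (kernelMatrix n c) = ⊥ := by
  by_contra hne
  have hst : ∀ P ∈ orbitAnnihilator n (kernelMatrix n c), ∀ x : S2,
      ad (dspin n (Complex.I • pauli x.1)) P ∈ orbitAnnihilator n (kernelMatrix n c) := by
    intro P hP x g
    have h1 := hasDerivAt_trace_opAct_circle n x P (opAct n g (kernelMatrix n c))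
    have h2 (t : ℝ) : (opAct n (circle x t) P * opAct n g (kernelMatrix n c)).trace = 0 := by
      rw [trace_opAct_mul, ← opAct_mul]
      exact hP _
    simp only [h2] at h1
    exact h1.unique (hasDerivAt_const _ _)
  obtain ⟨l, hl, hmem⟩ := exists_coupled_mem hne (fun A hA => (ad_dspin_mem (hst A hA)).1)
    (fun A hA => (ad_dspin_mem (hst A hA)).2)
  have h1 := hmem 1
  have h2 := trace_coupled_mul_kernelMatrix n c ⟨l, by omega⟩
  rw [opAct_one] at h1
  simp only [h1] at h2
  exact kernelCoeff_ne_zero hc _ (by exact_mod_cast h2.symm)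

/-! ### The symbol map of a diagonal matrix -/

/-- The operator `x · J = x₁ J₁ + x₂ J₂ + x₃ J₃`. -/
def spinVec (n : ℕ) (x : E3) : Op n := dspin n ((1 / 2 : ℂ) • pauli x)

theorem spinVec_eq (n : ℕ) (x : E3) : spinVec n x = ((x 2 : ℝ) : ℂ) • Jz n +
    (((x 0 : ℝ) - (x 1 : ℝ) * Complex.I) / 2 : ℂ) • Jplus n +
    (((x 0 : ℝ) + (x 1 : ℝ) * Complex.I) / 2 : ℂ) • Jminus n := by
  simp only [spinVec, dspin, pauli_eq, Matrix.smul_apply, Matrix.of_apply, Matrix.cons_val',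
    Matrix.cons_val_zero, Matrix.cons_val_one, Matrix.cons_val_fin_one, smul_eq_mul]
  module

theorem spinVec_northPole (n : ℕ) : spinVec n northPole.1 = Jz n := by
  simp [spinVec_eq, northPole]

theorem spinVec_conjTranspose (n : ℕ) (x : E3) : (spinVec n x)ᴴ = spinVec n x := by
  rw [spinVec_eq]
  simp only [Matrix.conjTranspose_add, Matrix.conjTranspose_smul, Jz_conjTranspose,
    Jplus_conjTranspose, Jminus_conjTranspose]
  simp [sub_eq_add_neg]
  abel

theorem semiconjBy_spinVec (n : ℕ) (g : SU2) (x : E3) :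
    SemiconjBy (spinRep n g) (spinVec n x) (spinVec n (rotVec g x)) := by
  refine spinMatrix_mul_dspin n (by rw [g.det_eq_one]; exact one_ne_zero) ?_
  rw [pauli_rotVec, mul_smul_comm, smul_mul_assoc, mul_assoc, g.star_mul_self, mul_one]

theorem semiconjBy_aeval {n : ℕ} {S A B : Op n} (h : SemiconjBy S A B) (p : Polynomial ℝ) :
    SemiconjBy S (Polynomial.aeval A p) (Polynomial.aeval B p) := by
  rw [SemiconjBy, Polynomial.aeval_eq_sum_range, Polynomial.aeval_eq_sum_range, Finset.mul_sum,
    Finset.sum_mul]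
  refine Finset.sum_congr rfl fun i _ => ?_
  rw [mul_smul_comm, smul_mul_assoc, (h.pow_right i).eq]

theorem opAct_aeval_spinVec (n : ℕ) (p : Polynomial ℝ) (g : SU2) (x : E3) :
    opAct n g (Polynomial.aeval (spinVec n x) p) = Polynomial.aeval (spinVec n (rotVec g x)) p :=
  opAct_eq_of_semiconjBy (semiconjBy_aeval (semiconjBy_spinVec n g x) p)

theorem aeval_conjTranspose {n : ℕ} {A : Op n} (hA : Aᴴ = A) (p : Polynomial ℝ) :
    (Polynomial.aeval A p)ᴴ = Polynomial.aeval A p := by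
  rw [Polynomial.aeval_eq_sum_range, Matrix.conjTranspose_sum]
  refine Finset.sum_congr rfl fun i _ => ?_
  rw [Matrix.conjTranspose_smul, Matrix.conjTranspose_pow, hA]
  rfl

/-- The weights are distinct, so Lagrange interpolation applies. Replacing J₃ by x·J in the
polynomial then defines the symbol at x without choosing g with g n₀ = x. -/
theorem exists_aeval_Jz_eq (n : ℕ) (d : Fin (n + 1) → ℝ) :
    ∃ p : Polynomial ℝ, Polynomial.aeval (Jz n) p = Matrix.diagonal fun i => (d i : ℂ) := by
  set v : Fin (n + 1) → ℝ := fun i => (n : ℝ) / 2 - (i : ℕ) with hv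
  have hinj : Function.Injective v := by
    intro i j hij
    simp only [hv, sub_right_inj, Nat.cast_inj] at hij
    exact Fin.ext hij
  refine ⟨Lagrange.interpolate Finset.univ v d, ?_⟩
  have hJ : Jz n = Matrix.diagonalAlgHom ℝ (fun i => ((v i : ℝ) : ℂ)) := by
    simp [Jz, hv]
  rw [hJ, Polynomial.aeval_algHom_apply]
  change Matrix.diagonal _ = _
  congr 1
  ext i
  have h1 : (Polynomial.aeval (fun i => ((v i : ℝ) : ℂ)) (Lagrange.interpolate Finset.univ v d)) i =
      Polynomial.aeval ((v i : ℝ) : ℂ) (Lagrange.interpolate Finset.univ v d) :=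
    (Polynomial.aeval_algHom_apply (Pi.evalAlgHom ℝ (fun _ : Fin (n + 1) => ℂ) i) _ _).symm
  have h2 : Polynomial.aeval ((v i : ℝ) : ℂ) (Lagrange.interpolate Finset.univ v d) =
      ((Polynomial.eval (v i) (Lagrange.interpolate Finset.univ v d) : ℝ) : ℂ) :=
    Polynomial.aeval_algebraMap_apply_eq_algebraMap_eval _ _
  rw [h1, h2, Lagrange.eval_interpolate_at_node _ hinj.injOn (Finset.mem_univ i)]

/-- The map `P ↦ (x ↦ trace (P p(x·J)))`. -/
def polySymbol (n : ℕ) (p : Polynomial ℝ) : Op n →ₗ[ℂ] (S2 → ℂ) where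
  toFun P x := (P * Polynomial.aeval (spinVec n x.1) p).trace
  map_add' P Q := by
    ext x
    simp only [add_mul, Matrix.trace_add, Pi.add_apply]
  map_smul' c P := by
    ext x
    simp only [smul_mul_assoc, Matrix.trace_smul, Pi.smul_apply, RingHom.id_apply]

theorem polySymbol_apply (n : ℕ) (p : Polynomial ℝ) (P : Op n) (x : S2) :
    polySymbol n p P x = (P * Polynomial.aeval (spinVec n x.1) p).trace := rfl

theorem isGivenBy_polySymbol {n : ℕ} {p : Polynomial ℝ} {K : Op n}
    (hp : Polynomial.aeval (Jz n) p = K) : IsGivenBy n (polySymbol n p) K := by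
  intro P g
  rw [polySymbol_apply, ← hp, ← spinVec_northPole, opAct_aeval_spinVec]
  rfl

theorem contDiff_spinVec_apply (n : ℕ) (k i : Fin (n + 1)) :
    ContDiff ℝ ∞ fun x : E3 => spinVec n x k i := by
  have h (j : Fin 3) : ContDiff ℝ ∞ fun x : E3 => ((x j : ℝ) : ℂ) :=
    Complex.ofRealCLM.contDiff.comp (EuclideanSpace.proj (𝕜 := ℝ) j).contDiff
  have h0 := h 0
  have h1 := h 1
  have h2 := h 2
  simp only [spinVec_eq, Matrix.add_apply, Matrix.smul_apply, smul_eq_mul, div_eq_mul_inv]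
  fun_prop

theorem contDiff_aeval_spinVec_apply (n : ℕ) (p : Polynomial ℝ) (k i : Fin (n + 1)) :
    ContDiff ℝ ∞ fun x : E3 => (Polynomial.aeval (spinVec n x) p) k i := by
  have hpow (m : ℕ) : ∀ k i, ContDiff ℝ ∞ fun x : E3 => (spinVec n x ^ m) k i := by
    induction m with
    | zero =>
      intro k i
      simp only [pow_zero]
      exact contDiff_const
    | succ m ih =>
      intro k i
      simp only [pow_succ, Matrix.mul_apply]
      exact ContDiff.sum fun j _ => (ih k j).mul (contDiff_spinVec_apply n j i)
  simp only [Polynomial.aeval_eq_sum_range, Matrix.sum_apply, Matrix.smul_apply]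
  exact ContDiff.sum fun m _ => (hpow m k i).const_smul _

theorem contMDiff_polySymbol (n : ℕ) (p : Polynomial ℝ) (P : Op n) :
    ContMDiff (𝓡 2) 𝓘(ℝ, ℂ) ∞ (polySymbol n p P) := by
  have h : ContDiff ℝ ∞ fun x : E3 => (P * Polynomial.aeval (spinVec n x) p).trace := by
    simp only [Matrix.trace, Matrix.diag_apply, Matrix.mul_apply]
    exact ContDiff.sum fun k _ => ContDiff.sum fun i _ =>
      contDiff_const.mul (contDiff_aeval_spinVec_apply n p i k)
  exact h.contMDiff.comp contMDiff_coe_sphere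

theorem polySymbol_conjTranspose (n : ℕ) (p : Polynomial ℝ) (P : Op n) (x : S2) :
    polySymbol n p Pᴴ x = star (polySymbol n p P x) := by
  rw [polySymbol_apply, polySymbol_apply, ← Matrix.trace_conjTranspose, Matrix.conjTranspose_mul,
    aeval_conjTranspose (spinVec_conjTranspose n _), Matrix.trace_mul_comm]

theorem IsGivenBy.equivariant {n : ℕ} {W : Op n →ₗ[ℂ] (S2 → ℂ)} {K : Op n} (h : IsGivenBy n W K)
    (g : SU2) (P : Op n) (x : S2) : W (opAct n g P) x = W P (rot g⁻¹ x) := by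
  obtain ⟨k, rfl⟩ := exists_rot_northPole x
  rw [h, ← rot_mul, h, trace_opAct_mul, opAct_mul]

theorem IsGivenBy.unique {n : ℕ} {W W' : Op n →ₗ[ℂ] (S2 → ℂ)} {K : Op n} (h : IsGivenBy n W K)
    (h' : IsGivenBy n W' K) : W = W' := by
  ext P x
  obtain ⟨k, rfl⟩ := exists_rot_northPole x
  rw [h, h']

theorem IsGivenBy.kernel_unique {n : ℕ} {W : Op n →ₗ[ℂ] (S2 → ℂ)} {K K' : Op n}
    (h : IsGivenBy n W K) (h' : IsGivenBy n W K') : K = K' := by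
  refine Matrix.ext_iff_trace_mul_left.2 fun P => ?_
  have h1 := h P 1
  rwa [h' P 1, opAct_one, opAct_one, eq_comm] at h1

/-! ### Averaging over the sphere and normalization -/

theorem integrable_aeval_spinVec_apply (n : ℕ) (p : Polynomial ℝ) (k i : Fin (n + 1)) :
    MeasureTheory.Integrable (fun x : S2 => (Polynomial.aeval (spinVec n x.1) p) k i)
      (MeasureTheory.volume : MeasureTheory.Measure E3).toSphere :=
  ((contDiff_aeval_spinVec_apply n p k i).continuous.comp
    continuous_subtype_val).integrable_of_hasCompactSupport (HasCompactSupport.of_compactSpace _)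

/-- The integral over `S²` of the operator-valued function `p(x·J)`. -/
def averageOp (n : ℕ) (p : Polynomial ℝ) : Op n :=
  Matrix.of fun k i => ∫ x : S2, (Polynomial.aeval (spinVec n x.1) p) k i
    ∂(MeasureTheory.volume : MeasureTheory.Measure E3).toSphere

theorem integral_mul_apply (n : ℕ) (p : Polynomial ℝ) (A B : Op n) (k i : Fin (n + 1)) :
    ∫ x : S2, (A * Polynomial.aeval (spinVec n x.1) p * B) k i
      ∂(MeasureTheory.volume : MeasureTheory.Measure E3).toSphere =
      (A * averageOp n p * B) k i := by
  simp only [Matrix.mul_apply]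
  rw [MeasureTheory.integral_finsetSum]
  · refine Finset.sum_congr rfl fun j _ => ?_
    rw [MeasureTheory.integral_mul_const, MeasureTheory.integral_finsetSum]
    · congr 1
      refine Finset.sum_congr rfl fun m _ => ?_
      rw [MeasureTheory.integral_const_mul]
      rfl
    · exact fun m _ => (integrable_aeval_spinVec_apply n p m j).const_mul _
  · exact fun j _ => (MeasureTheory.integrable_finsetSum _ fun m _ =>
      (integrable_aeval_spinVec_apply n p m j).const_mul _).mul_const _

theorem integral_polySymbol (n : ℕ) (p : Polynomial ℝ) (P : Op n) :
    ∫ x, polySymbol n p P x ∂(MeasureTheory.volume : MeasureTheory.Measure E3).toSphere =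
      (P * averageOp n p).trace := by
  have h (k : Fin (n + 1)) := integral_mul_apply n p P 1 k k
  simp only [mul_one] at h
  simp only [polySymbol_apply, Matrix.trace, Matrix.diag_apply, ← h]
  refine MeasureTheory.integral_finsetSum _ fun k _ => ?_
  simp only [Matrix.mul_apply]
  exact MeasureTheory.integrable_finsetSum _ fun m _ =>
      (integrable_aeval_spinVec_apply n p m k).const_mul _

theorem opAct_averageOp (n : ℕ) (p : Polynomial ℝ) (g : SU2) :
    opAct n g (averageOp n p) = averageOp n p := by
  ext k i
  rw [opAct, ← integral_mul_apply]
  have h (x : S2) : spinRep n g * Polynomial.aeval (spinVec n x.1) p * spinRep n g⁻¹ =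
      Polynomial.aeval (spinVec n (rot g x).1) p := opAct_aeval_spinVec n p g x.1
  simp only [h]
  exact integral_comp_rot g fun x => (Polynomial.aeval (spinVec n x.1) p) k i

/-- The averaged operator is invariant, hence scalar by Schur, and P = 1, whose symbol is the
constant 1, determines the scalar. -/
theorem normalized_polySymbol {n : ℕ} {p : Polynomial ℝ}
    (hp : (Polynomial.aeval (Jz n) p).trace = 1) (P : Op n) :
    (1 / (4 * Real.pi) : ℂ) * ∫ x, polySymbol n p P x
      ∂(MeasureTheory.volume : MeasureTheory.Measure E3).toSphere = (1 / (n + 1) : ℂ) * P.trace := by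
  obtain ⟨c, hc⟩ := eq_smul_one_of_opAct_eq (opAct_averageOp n p)
  have hn : (n + 1 : ℂ) ≠ 0 := by exact_mod_cast Nat.succ_ne_zero n
  have hpi : (Real.pi : ℂ) ≠ 0 := by exact_mod_cast Real.pi_ne_zero
  have hone : ∀ x, polySymbol n p 1 x = 1 := by
    intro x
    obtain ⟨g, rfl⟩ := exists_rot_northPole x
    rw [isGivenBy_polySymbol rfl 1 g, one_mul, trace_opAct, hp]
  have h1 := integral_polySymbol n p 1
  simp only [hone, MeasureTheory.integral_const, toSphere_real_univ, one_mul, hc,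
    Matrix.trace_smul, Matrix.trace_one, Fintype.card_fin] at h1
  have hc' : c = 4 * Real.pi / (n + 1) := by
    rw [eq_div_iff hn]
    simpa using h1.symm
  rw [integral_polySymbol, hc, mul_smul_comm, mul_one, Matrix.trace_smul, smul_eq_mul, hc']
  field_simp

/-- Every kernel with nonzero coefficients gives a symbol correspondence. -/
theorem exists_isSymbolCorrespondence {n : ℕ} {c : Fin n → ℝ} (hc : ∀ i, c i ≠ 0) :
    ∃ W : Op n →ₗ[ℂ] (S2 → ℂ), IsSymbolCorrespondence n W ∧ IsGivenBy n W (kernelMatrix n c) := by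
  obtain ⟨d, hd⟩ := kernelMatrix_eq_diagonal n c
  obtain ⟨p, hp⟩ := exists_aeval_Jz_eq n d
  rw [← hd] at hp
  have hg := isGivenBy_polySymbol hp
  refine ⟨polySymbol n p, ⟨contMDiff_polySymbol n p, ?_, hg.equivariant,
    polySymbol_conjTranspose n p, normalized_polySymbol (by rw [hp, trace_kernelMatrix])⟩, hg⟩
  rw [injective_iff_map_eq_zero]
  intro P hP
  rw [← Submodule.mem_bot ℂ, ← orbitAnnihilator_eq_bot hc, mem_orbitAnnihilator]
  intro g
  rw [← hg, hP]
  rfl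

/-! ### The kernel of a symbol correspondence -/

theorem exists_trace_mul_eq {n : ℕ} (f : Op n →ₗ[ℂ] ℂ) : ∃ K : Op n, ∀ P, f P = (P * K).trace := by
  refine ⟨Matrix.of fun i k => f (Matrix.single k i 1), fun P => ?_⟩
  conv_lhs => rw [Matrix.matrix_eq_sum_single P]
  simp only [map_sum, Matrix.trace, Matrix.diag_apply, Matrix.mul_apply, Matrix.of_apply]
  refine Finset.sum_congr rfl fun k _ => Finset.sum_congr rfl fun i _ => ?_
  rw [← smul_eq_mul, ← map_smul, Matrix.smul_single, smul_eq_mul, mul_one]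

theorem rot_circle_northPole (t : ℝ) : rot (circle northPole t) northPole = northPole := by
  apply Subtype.ext
  apply pauli_injective
  change pauli (rotVec _ northPole.1) = _
  have h : Commute (circle northPole t).1 (pauli northPole.1) := by
    rw [circle_coe]
    exact ((Commute.one_left _).smul_left _).add_left ((Commute.refl _).smul_left _)
  have hu : (circle northPole t).1 * star (circle northPole t).1 = 1 :=
    Matrix.mem_unitaryGroup_iff.1 (Matrix.mem_specialUnitaryGroup_iff.1 (circle northPole t).2).1
  rw [pauli_rotVec, h.eq, mul_assoc, hu, mul_one]

/-- The trace form represents the functional P ↦ W_P(n₀), and equivariance carries the formula from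
n₀ to every point. -/
theorem IsSymbolCorrespondence.exists_isGivenBy {n : ℕ} {W : Op n →ₗ[ℂ] (S2 → ℂ)}
    (hW : IsSymbolCorrespondence n W) : ∃ K : Op n, IsGivenBy n W K := by
  obtain ⟨K, hK⟩ := exists_trace_mul_eq ((LinearMap.proj northPole : (S2 → ℂ) →ₗ[ℂ] ℂ) ∘ₗ W)
  refine ⟨K, fun P g => ?_⟩
  have h := hW.equivariant g⁻¹ P northPole
  rw [inv_inv] at h
  have h1 := hK (opAct n g⁻¹ P)
  rw [trace_opAct_mul, inv_inv] at h1
  rw [← h, ← h1]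
  rfl

theorem IsGivenBy.apply_northPole {n : ℕ} {W : Op n →ₗ[ℂ] (S2 → ℂ)} {K : Op n}
    (h : IsGivenBy n W K) (P : Op n) : W P northPole = (P * K).trace := by
  have h1 := h P 1
  rwa [rot_one, opAct_one] at h1

theorem IsGivenBy.opAct_circle {n : ℕ} {W : Op n →ₗ[ℂ] (S2 → ℂ)} {K : Op n}
    (h : IsGivenBy n W K) (t : ℝ) : opAct n (circle northPole t) K = K := by
  refine Matrix.ext_iff_trace_mul_left.2 fun P => ?_
  rw [← h P, rot_circle_northPole, h.apply_northPole]

/-- Rotations about n₀ fix K; differentiating, K commutes with J₃, whose diagonal entries are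
distinct. -/
theorem IsGivenBy.apply_eq_zero_of_ne {n : ℕ} {W : Op n →ₗ[ℂ] (S2 → ℂ)} {K : Op n}
    (h : IsGivenBy n W K) {k i : Fin (n + 1)} (hki : k ≠ i) : K k i = 0 := by
  have h1 : ad (dspin n (Complex.I • pauli northPole.1)) K = 0 := by
    refine Matrix.ext_iff_trace_mul_right.2 fun B => ?_
    have h2 := hasDerivAt_trace_opAct_circle n northPole K B
    simp only [h.opAct_circle] at h2
    rw [h2.unique (hasDerivAt_const _ _), zero_mul, Matrix.trace_zero]
  have e : dspin n (Complex.I • pauli northPole.1) = (2 * Complex.I) • Jz n := by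
    simp [dspin, pauli_eq, northPole, two_mul]
  have h2 := congrFun (congrFun h1 k) i
  rw [e, ad_apply, smul_mul_assoc, mul_smul_comm, ← smul_sub, Matrix.smul_apply, Matrix.sub_apply,
    Jz, Matrix.diagonal_mul, Matrix.mul_diagonal, Matrix.zero_apply, smul_eq_mul, mul_eq_zero] at h2
  have h3 := h2.resolve_left (by simp)
  have h4 : ((i : ℕ) - (k : ℕ) : ℂ) ≠ 0 := by
    rw [sub_ne_zero]
    exact_mod_cast fun h : (i : ℕ) = k => hki (Fin.ext h.symm)
  exact (mul_eq_zero.1 (show ((i : ℕ) - (k : ℕ) : ℂ) * K k i = 0 by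
    linear_combination h3)).resolve_left h4

theorem IsSymbolCorrespondence.conjTranspose_kernel {n : ℕ} {W : Op n →ₗ[ℂ] (S2 → ℂ)} {K : Op n}
    (hW : IsSymbolCorrespondence n W) (h : IsGivenBy n W K) : Kᴴ = K := by
  refine Matrix.ext_iff_trace_mul_left.2 fun P => ?_
  have h1 := hW.real Pᴴ northPole
  rw [h.apply_northPole, h.apply_northPole, Matrix.conjTranspose_conjTranspose,
    ← Matrix.trace_conjTranspose, Matrix.conjTranspose_mul, Matrix.conjTranspose_conjTranspose,
    Matrix.trace_mul_comm Kᴴ] at h1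
  exact h1.symm

theorem IsSymbolCorrespondence.trace_kernel {n : ℕ} {W : Op n →ₗ[ℂ] (S2 → ℂ)} {K : Op n}
    (hW : IsSymbolCorrespondence n W) (h : IsGivenBy n W K) : K.trace = 1 := by
  have hone : ∀ x, W 1 x = K.trace := by
    intro x
    obtain ⟨g, rfl⟩ := exists_rot_northPole x
    rw [h, one_mul, trace_opAct]
  have hn : (n + 1 : ℂ) ≠ 0 := by exact_mod_cast Nat.succ_ne_zero n
  have hpi : (Real.pi : ℂ) ≠ 0 := by exact_mod_cast Real.pi_ne_zero
  have h1 := hW.normalized 1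
  simp only [hone, MeasureTheory.integral_const, toSphere_real_univ, Matrix.trace_one,
    Fintype.card_fin, Complex.real_smul] at h1
  push_cast at h1
  field_simp at h1
  exact h1

theorem IsSymbolCorrespondence.exists_kernelMatrix {n : ℕ} {W : Op n →ₗ[ℂ] (S2 → ℂ)}
    (hW : IsSymbolCorrespondence n W) :
    ∃ c : Fin n → ℝ, (∀ i, c i ≠ 0) ∧ IsGivenBy n W (kernelMatrix n c) := by
  obtain ⟨K, hK⟩ := hW.exists_isGivenBy
  have hdiag : K = Matrix.diagonal fun i => (((K i i).re : ℝ) : ℂ) := by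
    ext k i
    rw [Matrix.diagonal_apply]
    split_ifs with hki
    · subst hki
      exact (Complex.conj_eq_iff_re.1 (congrFun (congrFun (hW.conjTranspose_kernel hK) k) k)).symm
    · exact hK.apply_eq_zero_of_ne hki
  obtain ⟨κ, hκ⟩ := exists_diagonal_eq_sum_coupled fun i => (K i i).re
  rw [← hdiag] at hκ
  -- With κ_l = 0, the matrix `coupled n l` is orthogonal to the whole orbit of K, so its symbol
  -- vanishes and injectivity fails.
  have hne (l : Fin (n + 1)) : κ l ≠ 0 := by
    intro h0
    have hW0 : W (coupled n l) = 0 := by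
      ext x
      obtain ⟨g, rfl⟩ := exists_rot_northPole x
      rw [hK, hκ, ← opActLin_apply, map_sum, Finset.mul_sum, Matrix.trace_sum]
      refine Finset.sum_eq_zero fun l' _ => ?_
      rw [map_smul, mul_smul_comm, Matrix.trace_smul, opActLin_apply]
      by_cases hl : l = l'
      · rw [← hl, h0, Complex.ofReal_zero, zero_smul]
      · rw [trace_coupled_mul_opAct_coupled (fun h => hl (Fin.ext h)), smul_zero]
    have h1 : coupled n l = 0 := hW.injective (by rw [hW0, map_zero])
    have h2 := trace_coupled_mul_self (n := n) (l := l) (by omega)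
    simp [h1] at h2
  -- `coupled n 0` is a multiple of the identity, so trace K = 1 fixes this coefficient.
  have hzero : κ 0 = Real.sqrt (1 / (n + 1)) := by
    have h1 := trace_coupled_mul_sum κ 0
    rw [← hκ, Fin.val_zero, coupled_zero, smul_mul_assoc, one_mul, Matrix.trace_smul,
      hW.trace_kernel hK, smul_eq_mul, mul_one, Complex.ofReal_inj] at h1
    exact h1.symm
  refine ⟨fun i => κ i.succ / Real.sqrt ((2 * ((i : ℕ) + 1) + 1) / (n + 1)),
    fun i => div_ne_zero (hne _) (kernelCoeff_succ_pos n i).ne', ?_⟩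
  convert hK
  rw [kernelMatrix_eq_sum, hκ]
  congr 1
  ext1 l
  congr 2
  refine Fin.cases ?_ (fun i => ?_) l
  · exact hzero.symm
  · exact div_mul_cancel₀ _ (kernelCoeff_succ_pos n i).ne'

/-! ### Assembling the bijections -/

/-- The bijection from the tuples of nonzero real numbers onto the symbol correspondences. -/
theorem exists_equiv_symbolCorrespondence (n : ℕ) :
    ∃ Ψ : {c : Fin n → ℝ // ∀ i, c i ≠ 0} ≃
        {W : Op n →ₗ[ℂ] (S2 → ℂ) // IsSymbolCorrespondence n W},
      ∀ c, IsGivenBy n (Ψ c).1 (kernelMatrix n c.1) := by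
  choose F hF hFK using fun c : {c : Fin n → ℝ // ∀ i, c i ≠ 0} => exists_isSymbolCorrespondence c.2
  refine ⟨Equiv.ofBijective (fun c => ⟨F c, hF c⟩) ⟨?_, ?_⟩, hFK⟩
  · intro c c' h
    have h1 : F c = F c' := congrArg Subtype.val h
    have h2 := hFK c
    rw [h1] at h2
    exact Subtype.ext (kernelMatrix_injective n (h2.kernel_unique (hFK c')))
  · rintro ⟨W, hW⟩
    obtain ⟨c, hc, hcW⟩ := hW.exists_kernelMatrix
    exact ⟨⟨c, hc⟩, Subtype.ext ((hFK ⟨c, hc⟩).unique hcW)⟩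

/-- The bijection from the tuples of nonzero real numbers onto the kernels. -/
def kernelSetEquiv (n : ℕ) : {c : Fin n → ℝ // ∀ i, c i ≠ 0} ≃ {K : Op n // K ∈ kernelSet n} :=
  Equiv.ofBijective (fun c => ⟨kernelMatrix n c.1, kernelMatrix_eq_diagonal n c.1, c.1, c.2, rfl⟩) ⟨
    fun c c' h => Subtype.ext (kernelMatrix_injective n (congrArg Subtype.val h)), by
    rintro ⟨K, -, c, hc, rfl⟩
    exact ⟨⟨c, hc⟩, rfl⟩⟩

end SpinJ

end

theorem theorem6p2p1 (n : ℕ) :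
    (∀ l : ℕ, 1 ≤ l → l ≤ n →
      SpinJ.coupled n l ∈ SpinJ.opSummand n l ∧
      (∃ d : Fin (n + 1) → ℝ, SpinJ.coupled n l = Matrix.diagonal fun i => (d i : ℂ)) ∧
      (SpinJ.coupled n l).trace = 0 ∧
      ((SpinJ.coupled n l)ᴴ * SpinJ.coupled n l).trace = 1) ∧
    (∃ Φ : {K : SpinJ.Op n // K ∈ SpinJ.kernelSet n} ≃
        {W : SpinJ.Op n →ₗ[ℂ] (SpinJ.S2 → ℂ) // SpinJ.IsSymbolCorrespondence n W},
      ∀ K, SpinJ.IsGivenBy n (Φ K).1 K.1) ∧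
    (∃ Ψ : {c : Fin n → ℝ // ∀ i, c i ≠ 0} ≃
        {W : SpinJ.Op n →ₗ[ℂ] (SpinJ.S2 → ℂ) // SpinJ.IsSymbolCorrespondence n W},
      ∀ c, SpinJ.IsGivenBy n (Ψ c).1 (SpinJ.kernelMatrix n c.1)) := by
  obtain ⟨Ψ, hΨ⟩ := SpinJ.exists_equiv_symbolCorrespondence n
  refine ⟨fun l hl hln => ⟨SpinJ.coupled_mem_opSummand n l, ⟨_, SpinJ.coupled_eq_diagonal n l⟩,
    SpinJ.trace_coupled hl, ?_⟩, ⟨(SpinJ.kernelSetEquiv n).symm.trans Ψ, fun K => ?_⟩, Ψ, hΨ⟩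
  · rw [SpinJ.coupled_conjTranspose, SpinJ.trace_coupled_mul_self hln]
  · obtain ⟨c, rfl⟩ := (SpinJ.kernelSetEquiv n).surjective K
    rw [Equiv.trans_apply, Equiv.symm_apply_apply]
    exact hΨ c
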